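/- Let $A$ be a finite-dimensional unital associative real algebra, not necessarily commutative, with a basis $(e_0,e_1,\dots,e_p)$ in which $e_0$ is the unit. Put $n=p+1$ and identify $A$ with $\mathbb R^{n}$ through this basis, writing $x=\sum_{i=0}^p x_ie_i$ and $\|x\|^2=\sum_{i=0}^p x_i^2$. A function $f$ with values in $A$ is called left $A$-differentiable on an open set $D\subset A$ if it is differentiable at every point of $D$ and $$\frac{\partial f}{\partial x_m}-e_m\frac{\partial f}{\partial x_0}=0\quad\text{on } D,\qquad m=1,\dots,p .$$ Write these conditions as $\sum_{j=0}^p a^j_m\,\frac{\partial f}{\partial x_j}=0$, that is, $a^0_m=-e_m$, $a^m_m=e_0$ and $a^j_m=0$ for the other $j$. Suppose that $$\sum_{m=0}^p e_m^2\in I\big(e_me_k-e_ke_m,\ 1\le k<m\le p\big),$$ where $I(\cdot)$ denotes the left ideal of $A$ generated by these elements. Then left $A$-differentiable functions satisfy a Cauchy formula: there are elements $b^i_m\in A$ ($0\le i\le p$, $1\le m\le p$), which depend only on $A$ and the basis, such that, with $\varphi_m(x,y)=\sum_{i=0}^p (y_i-x_i)\,b^i_m$, for every bounded open set $D\subset A$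 with smooth boundary, every function $f:\overline D\to A$ that is continuous on $\overline D$ and left $A$-differentiable on $D$, and every $x\in D$, $$f(x)=\int_{\partial D}\sum_{m=1}^p\frac{\varphi_m(x,y)}{\|y-x\|^{n}}\Big(\sum_{j=0}^p a^j_m\,\nu_j(y)\Big)f(y)\,d\sigma(y),$$ where $\sigma$ is the surface measure of $\partial D$ and $\nu=(\nu_0,\dots,\nu_p)$ its outward unit normal, and the integrand is integrable. Equivalently, the integral is that over $\partial D$ of the differential form $\sum_m\frac{\varphi_m(x,y)}{\|y-x\|^{n}}\big(\sum_j a^j_m\frac{\partial}{\partial y_j}\big)\lrcorner\,dV$, multiplied on the right by $f(y)$. -/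

import Mathlib

open MeasureTheory Filter Topology
open scoped ContDiff

noncomputable section

/-- An open set `D ⊆ ℝⁿ` (`n = p + 1`) has smooth (`C^∞`) boundary: near each of its boundary
points, `D` is, for some coordinate `z j`, one of the two sides `z j < γ` or `z j > γ` of the
graph of a smooth function `γ` of the other `p` coordinates. The sign `s` selects the side. -/
def HasSmoothBoundary {p : ℕ} (D : Set (EuclideanSpace ℝ (Fin (p + 1)))) : Prop :=
  ∀ y ∈ frontier D, ∃ (j : Fin (p + 1)) (s : ℝ) (γ : EuclideanSpace ℝ (Fin p) → ℝ)
    (U : Set (EuclideanSpace ℝ (Fin (p + 1)))),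
    (s = 1 ∨ s = -1) ∧ ContDiff ℝ ∞ γ ∧ IsOpen U ∧ y ∈ U ∧
      ∀ z ∈ U, z ∈ D ↔ s * z j < s * γ (WithLp.toLp 2 fun i => z (j.succAbove i))

/-- `v` is the outward unit normal to `D` at the boundary point `y`: every direction `w` making an
obtuse angle with `v` enters `D` at `y`, every direction making an acute angle with `v` leaves it.
For a domain with smooth boundary there is exactly one such unit vector, namely
`∇ρ(y) / ‖∇ρ(y)‖` when `D = {ρ < 0}` near `y` with `∇ρ(y) ≠ 0`. -/
def IsOutwardUnitNormal {n : ℕ} (D : Set (EuclideanSpace ℝ (Fin n)))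
    (y v : EuclideanSpace ℝ (Fin n)) : Prop :=
  ‖v‖ = 1 ∧
    (∀ w, inner ℝ v w < 0 → ∀ᶠ t : ℝ in 𝓝[>] 0, y + t • w ∈ D) ∧
    (∀ w, 0 < inner ℝ v w → ∀ᶠ t : ℝ in 𝓝[>] 0, y + t • w ∉ D)

/-- The function `f`, of the real coordinates `(x_0, …, x_p)` of the point `∑ x_i e_i` of `A`, is
left `A`-differentiable on `D`: it is differentiable at each point of `D`, with
`∂f/∂x_m = e_m ∂f/∂x_0` for `m = 1, …, p`. -/
def IsLeftADifferentiableOn {A : Type*} [NormedRing A] [NormedAlgebra ℝ A] {p : ℕ}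
    (e : Module.Basis (Fin (p + 1)) ℝ A) (f : EuclideanSpace ℝ (Fin (p + 1)) → A)
    (D : Set (EuclideanSpace ℝ (Fin (p + 1)))) : Prop :=
  ∀ x ∈ D, DifferentiableAt ℝ f x ∧ ∀ m : Fin p,
    fderiv ℝ f x (EuclideanSpace.single m.succ 1) =
      e m.succ * fderiv ℝ f x (EuclideanSpace.single 0 1)

/-- The coefficient `a^j_m` of `∂/∂x_j` in the `m`-th Cauchy condition
`∂f/∂x_m - e_m ∂f/∂x_0 = 0`. The index `m : Fin p` stands for `m + 1 ∈ {1, …, p}`. -/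
def cauchyCoeff {A : Type*} [NormedRing A] [NormedAlgebra ℝ A] {p : ℕ}
    (e : Module.Basis (Fin (p + 1)) ℝ A) (j : Fin (p + 1)) (m : Fin p) : A :=
  if j = 0 then -e m.succ else if j = m.succ then 1 else 0

/-- The linear polynomial `φ_m(z) = ∑_i z_i b^i_m` with coefficients in `A`. -/
def cauchyNumerator {A : Type*} [NormedRing A] [NormedAlgebra ℝ A] {p : ℕ}
    (b : Fin (p + 1) → Fin p → A) (m : Fin p) (z : EuclideanSpace ℝ (Fin (p + 1))) : A :=
  ∑ i, z i • b i m

/-- The density, with respect to the surface measure of the boundary, of the differential form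
`∑_m φ_m(y - x) / ‖y - x‖ⁿ (∑_j a^j_m ∂/∂y_j) ⌟ dV`, with `n = p + 1`, at a boundary point `y` with
outward unit normal `v`: the restriction to the boundary of `(∂/∂y_j) ⌟ dV` is `v_j` times the
surface measure. -/
def cauchyKernel {A : Type*} [NormedRing A] [NormedAlgebra ℝ A] {p : ℕ}
    (e : Module.Basis (Fin (p + 1)) ℝ A) (b : Fin (p + 1) → Fin p → A)
    (x y v : EuclideanSpace ℝ (Fin (p + 1))) : A :=
  (‖y - x‖ ^ (p + 1))⁻¹ •
    ∑ m, cauchyNumerator b m (y - x) * ∑ j, v j • cauchyCoeff e j m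

end

/-! Put $\Phi_i(z)=\sum_m\varphi_m(z)\,a^i_m$, with $\varphi_m$ now regarded as a function of
$z=y-x$. The Cauchy conditions give $\sum_i\Phi_i(z)\,\partial_i f=\sum_m\varphi_m(z)\sum_j
a^j_m\,\partial_j f=0$ for every choice of the $b^i_m$. If moreover $\sum_i z_i\Phi_i(z)=c\|z\|^2$
and $\sum_i\Phi_i(\epsilon_i)=nc$, where $\epsilon_i$ are the coordinate vectors, then
$\Phi(z)/\|z\|^n$ has divergence zero off the origin, like the Newtonian field $z/\|z\|^n$. Hence
the field $\Phi_i(y-x)f(y)/\|y-x\|^n$ is divergence free off $x$. Smoothing $\|z\|^{-n}$ inside a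
ball of radius $r$ around $x$ does not change the boundary integral and makes the divergence $c$
times a bump of scale $r$ times $f$; Gauss's theorem and $r\to0$ give the formula
(`cauchy_formula_of_kernel`), with $1/c$ the mass of the bump.

The ideal hypothesis is what makes such $b$ exist. It says $\sum_{m\ge0} e_m^2=\sum_{k,m}
B_{km}e_me_k$ with $B$ antisymmetric. For $k\ge1$ take $b^k_m=c(\delta_{km}-B_{km})$: the
antisymmetric part is invisible in the quadratic form. The choice $b^0_m=\sum_l b^m_l e_l$ cancels
the terms $z_0z_m$, and the relation for $B$ makes the coefficient of $z_0^2$ equal to $c$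
(`sum_smul_cauchyField`, `sum_cauchyField_single`).

Gauss's theorem is needed for fields that are continuous, and only differentiable inside $D$
(`integral_frontier_inner_normal_eq`). It is tested against cutoffs vanishing near the boundary,
whose gradients concentrate on the boundary graph; the area formula identifies the limit with a
Hausdorff integral, and a partition of unity globalizes. -/

noncomputable section

/-! ### The area formula for immersions. -/

section Area

open Module Metric Set
open scoped NNReal ENNReal

/-- If `f` contracts distances, relative to `g`, up to a factor `K`, then the Hausdorff measures of
the images compare accordingly. -/
theorem euclideanHausdorffMeasure_image_le_of_edist_le {U V : Type*} [MetricSpace V]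
    [MeasurableSpace V] [BorelSpace V] {f g : U → V} {s : Set U} {K : ℝ≥0} (d : ℕ)
    (hg : InjOn g s)
    (h : ∀ a ∈ s, ∀ b ∈ s, edist (f a) (f b) ≤ K * edist (g a) (g b)) :
    μHE[d] (f '' s) ≤ (K : ℝ≥0∞) ^ d * μHE[d] (g '' s) := by
  rcases s.eq_empty_or_nonempty with rfl | ⟨a₀, ha₀⟩
  · simp
  have : Nonempty U := ⟨a₀⟩
  have hinv : ∀ a ∈ s, Function.invFunOn g s (g a) = a := fun a ha => hg.leftInvOn_invFunOn ha
  have hL : LipschitzOnWith K (f ∘ Function.invFunOn g s) (g '' s) := by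
    rintro _ ⟨a, ha, rfl⟩ _ ⟨b, hb, rfl⟩
    simpa [hinv a ha, hinv b hb] using h a ha b hb
  have himg : f '' s = (f ∘ Function.invFunOn g s) '' (g '' s) := by
    rw [image_image]
    exact image_congr fun a ha => by simp [hinv a ha]
  have := hL.hausdorffMeasure_image_le (d := (d : ℝ)) (by positivity)
  rw [himg, Measure.euclideanHausdorffMeasure_def, Measure.smul_apply, Measure.smul_apply]
  rw [ENNReal.rpow_natCast] at this
  calc _ ≤ Measure.addHaarScalarFactor (volume : Measure (EuclideanSpace ℝ (Fin d))) μH[d] •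
        ((K : ℝ≥0∞) ^ d * μH[d] (g '' s)) := by gcongr
    _ = _ := by simp only [ENNReal.smul_def, smul_eq_mul]; ring

variable {U V : Type*} [NormedAddCommGroup U] [InnerProductSpace ℝ U] [FiniteDimensional ℝ U]
  [MeasurableSpace U] [BorelSpace U]
  [NormedAddCommGroup V] [InnerProductSpace ℝ V] [MeasurableSpace V] [BorelSpace V]

/-- Near a point of strict differentiability with injective derivative, the Hausdorff measure of the
image of small sets is nearly the measure of the set times the Jacobian. -/
theorem HasStrictFDerivAt.eventually_euclideanHausdorffMeasure_image {f : U → V} {T : U →L[ℝ] V}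
    {x : U} (hf : HasStrictFDerivAt f T x) (hT : Function.Injective T) {c : ℝ≥0} (hc : 1 < c) :
    ∀ᶠ s in (𝓝 x).smallSets,
      μHE[finrank ℝ U] (f '' s) ≤
        (c : ℝ≥0∞) ^ finrank ℝ U * (ENNReal.ofReal T.toLinearMap.normDet * volume s) ∧
      ENNReal.ofReal T.toLinearMap.normDet * volume s ≤
        (c : ℝ≥0∞) ^ finrank ℝ U * μHE[finrank ℝ U] (f '' s) := by
  obtain ⟨K, hK0, hK⟩ := T.toLinearMap.exists_antilipschitzWith (LinearMap.ker_eq_bot.2 hT)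
  have hKT : ∀ v, ‖v‖ ≤ K * ‖T v‖ := fun v => by
    simpa using hK.le_mul_dist v 0
  -- `K` bounds the inverse of `T` on its range, so an error `δ * ‖a - b‖` in `f` is at most `δ * K`
  -- relative to `T`. The two inequalities then make `f` and `T` comparable in both directions with
  -- the constant `c`.
  obtain ⟨δ, hδ0, hδ1, hδ2⟩ : ∃ δ : ℝ≥0, 0 < δ ∧ (1 + δ * K : ℝ) ≤ c ∧
      1 ≤ c * (1 - δ * K : ℝ) := by
    have hc' : (1 : ℝ) < c := by exact_mod_cast hc
    have h1 : Tendsto (fun δ : ℝ => 1 + δ * K) (𝓝[>] 0) (𝓝 1) := by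
      have : Continuous (fun δ : ℝ => 1 + δ * K) := by fun_prop
      simpa using (this.tendsto 0).mono_left nhdsWithin_le_nhds
    have h2 : Tendsto (fun δ : ℝ => c * (1 - δ * K)) (𝓝[>] 0) (𝓝 (c : ℝ)) := by
      have : Continuous (fun δ : ℝ => c * (1 - δ * K)) := by fun_prop
      simpa using (this.tendsto 0).mono_left nhdsWithin_le_nhds
    obtain ⟨δ, ⟨h3, h4⟩, h5⟩ := (((h1.eventually_le_const hc').and
      (h2.eventually_const_le hc')).and self_mem_nhdsWithin).exists
    exact ⟨⟨δ, le_of_lt h5⟩, h5, h3, h4⟩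
  obtain ⟨t, ht, hft⟩ := hf.approximates_deriv_on_nhds (c := δ) (Or.inr hδ0)
  filter_upwards [eventually_smallSets.2 ⟨t, ht, fun s hs => hs⟩] with s hs
  have key : ∀ a ∈ s, ∀ b ∈ s, ‖f a - f b - (T a - T b)‖ ≤ δ * K * ‖T a - T b‖ := by
    intro a ha b hb
    have h1 := hft a (hs ha) b (hs hb)
    have h2 := hKT (a - b)
    rw [map_sub] at h1 h2
    calc _ ≤ δ * ‖a - b‖ := h1
      _ ≤ δ * (K * ‖T a - T b‖) := by gcongr
      _ = _ := by ring
  have up : ∀ a ∈ s, ∀ b ∈ s, edist (f a) (f b) ≤ c * edist (T a) (T b) := by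
    intro a ha b hb
    have h1 : dist (f a) (f b) ≤ c * dist (T a) (T b) := by
      rw [dist_eq_norm, dist_eq_norm]
      have := norm_le_norm_add_norm_sub' (f a - f b) (T a - T b)
      have := key a ha b hb
      nlinarith [norm_nonneg (T a - T b)]
    rw [edist_nndist, edist_nndist]
    exact_mod_cast h1
  have down : ∀ a ∈ s, ∀ b ∈ s, edist (T a) (T b) ≤ c * edist (f a) (f b) := by
    intro a ha b hb
    have h1 : dist (T a) (T b) ≤ c * dist (f a) (f b) := by
      rw [dist_eq_norm, dist_eq_norm]
      have h3 := norm_le_norm_add_norm_sub (f a - f b) (T a - T b)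
      have h4 := key a ha b hb
      have h5 : (1 - δ * K) * ‖T a - T b‖ ≤ ‖f a - f b‖ := by linarith
      calc ‖T a - T b‖ ≤ c * (1 - δ * K) * ‖T a - T b‖ :=
            le_mul_of_one_le_left (norm_nonneg _) hδ2
        _ = c * ((1 - δ * K) * ‖T a - T b‖) := by ring
        _ ≤ _ := by gcongr
    rw [edist_nndist, edist_nndist]
    exact_mod_cast h1
  have hinj : InjOn f s := by
    intro a ha b hb hab
    have := down a ha b hb
    rw [hab, edist_self, mul_zero, nonpos_iff_eq_zero, edist_eq_zero] at this
    exact hT this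
  -- The Jacobian times the volume is the measure of `T '' s`, so both bounds compare two images of
  -- the same set.
  rw [← T.toLinearMap.euclideanHausdorffMeasure_image_eq_normDet_mul_volume]
  exact ⟨euclideanHausdorffMeasure_image_le_of_edist_le _ hT.injOn up,
    euclideanHausdorffMeasure_image_le_of_edist_le _ hinj down⟩

/-- The **area formula** for an injective immersion between inner product spaces. -/
theorem comap_euclideanHausdorffMeasure_eq_withDensity {f : U → V} {f' : U → U →L[ℝ] V}
    (hf : ∀ x, HasStrictFDerivAt f (f' x) x) (he : MeasurableEmbedding f)
    (hf' : ∀ x, Function.Injective (f' x)) :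
    (μHE[finrank ℝ U] : Measure V).comap f =
      volume.withDensity fun x => ENNReal.ofReal (f' x).toLinearMap.normDet := by
  set ρ : Measure U := (μHE[finrank ℝ U] : Measure V).comap f with hρ
  have hρa : ∀ s, ρ s = μHE[finrank ℝ U] (f '' s) := fun s => he.comap_apply _ s
  have hloc : ∀ x, ∀ c : ℝ≥0, 1 < c → ∀ᶠ s in (𝓝 x).smallSets,
      ρ s ≤ (c : ℝ≥0∞) ^ finrank ℝ U *
        (ENNReal.ofReal (f' x).toLinearMap.normDet * volume s) ∧
      ENNReal.ofReal (f' x).toLinearMap.normDet * volume s ≤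
        (c : ℝ≥0∞) ^ finrank ℝ U * ρ s := fun x c hc => by
    simpa only [hρa] using
      (hf x).eventually_euclideanHausdorffMeasure_image (hf' x) hc
  have : IsLocallyFiniteMeasure ρ := ⟨fun x => by
    obtain ⟨t, ht, h⟩ := eventually_smallSets.1 (hloc x 2 (by norm_num))
    obtain ⟨r, hr, hrt⟩ := Metric.nhds_basis_closedBall.mem_iff.1 ht
    refine ⟨closedBall x r, closedBall_mem_nhds x hr, (h _ hrt).1.trans_lt ?_⟩
    exact ENNReal.mul_lt_top (by simp) (ENNReal.mul_lt_top (by simp)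
      (measure_closedBall_lt_top))⟩
  have hac : ρ ≪ volume := by
    refine Measure.AbsolutelyContinuous.mk fun s _ hs0 => ?_
    refine measure_null_of_locally_null s fun x _ => ?_
    obtain ⟨t, ht, h⟩ := eventually_smallSets.1 (hloc x 2 (by norm_num))
    refine ⟨s ∩ t, inter_mem self_mem_nhdsWithin (mem_nhdsWithin_of_mem_nhds ht), ?_⟩
    have := (h (s ∩ t) inter_subset_right).1
    rw [measure_mono_null inter_subset_left hs0] at this
    simpa using this
  rw [← Measure.withDensity_rnDeriv_eq ρ volume hac]
  refine withDensity_congr_ae ?_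
  -- The density is almost everywhere the limit of ratios over shrinking balls. The local comparison
  -- traps it between multiples of the Jacobian by powers of `c`, and then `c` tends to 1.
  filter_upwards [Besicovitch.ae_tendsto_rnDeriv ρ (volume : Measure U)] with x hx
  set J := ENNReal.ofReal (f' x).toLinearMap.normDet
  set L := ρ.rnDeriv volume x
  have hballs : Tendsto (fun r => closedBall x r) (𝓝[>] 0) (𝓝 x).smallSets := by
    refine tendsto_smallSets_iff.2 fun t ht => ?_
    obtain ⟨r, hr, hrt⟩ := Metric.nhds_basis_closedBall.mem_iff.1 ht
    filter_upwards [Ioc_mem_nhdsGT hr] with r' hr'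
    exact (closedBall_subset_closedBall hr'.2).trans hrt
  have hv : ∀ r > 0, volume (closedBall x r) ≠ 0 ∧ volume (closedBall x r) ≠ ⊤ := fun r hr =>
    ⟨(measure_closedBall_pos _ _ hr).ne', measure_closedBall_lt_top.ne⟩
  have hup : ∀ c : ℝ≥0, 1 < c → L ≤ (c : ℝ≥0∞) ^ finrank ℝ U * J := fun c hc => by
    refine le_of_tendsto hx ?_
    filter_upwards [hballs.eventually (hloc x c hc), self_mem_nhdsWithin] with r hr hr0
    obtain ⟨h0, h1⟩ := hv r hr0
    rw [ENNReal.div_le_iff h0 h1, mul_assoc]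
    exact hr.1
  have hdown : ∀ c : ℝ≥0, 1 < c → J ≤ (c : ℝ≥0∞) ^ finrank ℝ U * L := fun c hc => by
    refine ge_of_tendsto (ENNReal.Tendsto.const_mul hx (Or.inr (by simp))) ?_
    filter_upwards [hballs.eventually (hloc x c hc), self_mem_nhdsWithin] with r hr hr0
    obtain ⟨h0, h1⟩ := hv r hr0
    rw [← mul_div_assoc, ENNReal.le_div_iff_mul_le (Or.inl h0) (Or.inl h1)]
    exact hr.2
  have hJ : J ≠ ⊤ := ENNReal.ofReal_ne_top
  have hL : L ≠ ⊤ := ((hup 2 (by norm_num)).trans_lt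
    (ENNReal.mul_lt_top (by simp) hJ.lt_top)).ne
  have hlim : ∀ a : ℝ≥0∞, a ≠ ⊤ →
      Tendsto (fun c : ℝ≥0 => (c : ℝ≥0∞) ^ finrank ℝ U * a) (𝓝[>] 1) (𝓝 a) := fun a ha => by
    have h1 : Tendsto (fun c : ℝ≥0 => (c : ℝ≥0∞) ^ finrank ℝ U) (𝓝[>] 1) (𝓝 1) := by
      have : Continuous fun c : ℝ≥0 => (((c ^ finrank ℝ U : ℝ≥0)) : ℝ≥0∞) := by fun_prop
      simpa using (this.tendsto 1).mono_left nhdsWithin_le_nhds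
    simpa using ENNReal.Tendsto.mul_const h1 (Or.inr ha)
  have : (𝓝[>] (1 : ℝ≥0)).NeBot := nhdsGT_neBot 1
  exact le_antisymm
    (ge_of_tendsto (hlim J hJ) (by filter_upwards [self_mem_nhdsWithin] with c hc using hup c hc))
    (ge_of_tendsto (hlim L hL) (by filter_upwards [self_mem_nhdsWithin] with c hc using hdown c hc))

end Area

/-! ### Graphs of functions and their surface measure. -/

section Graph

variable {p : ℕ}

/-- The point of `ℝ^{p+1}` with `j`-th coordinate `q.2` and other coordinates `q.1`. -/
def insertCoord (j : Fin (p + 1)) :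
    (EuclideanSpace ℝ (Fin p) × ℝ) →L[ℝ] EuclideanSpace ℝ (Fin (p + 1)) :=
  LinearMap.toContinuousLinearMap
    { toFun := fun q => WithLp.toLp 2 (j.insertNth q.2 q.1 : Fin (p + 1) → ℝ)
      map_add' := fun a b => by
        ext i
        induction i using Fin.succAboveCases j with
        | x => simp
        | p i => simp
      map_smul' := fun a b => by
        ext i
        induction i using Fin.succAboveCases j with
        | x => simp
        | p i => simp }

/-- The projection of `ℝ^{p+1}` forgetting the `j`-th coordinate. -/
def removeCoord (j : Fin (p + 1)) :
    EuclideanSpace ℝ (Fin (p + 1)) →L[ℝ] EuclideanSpace ℝ (Fin p) :=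
  LinearMap.toContinuousLinearMap
    { toFun := fun z => WithLp.toLp 2 fun i => z (j.succAbove i)
      map_add' := fun a b => by ext; simp
      map_smul' := fun a b => by ext; simp }

theorem insertCoord_apply (j : Fin (p + 1)) (q : EuclideanSpace ℝ (Fin p) × ℝ) :
    insertCoord j q = WithLp.toLp 2 (j.insertNth q.2 q.1 : Fin (p + 1) → ℝ) := rfl

theorem removeCoord_eq (j : Fin (p + 1)) (z : EuclideanSpace ℝ (Fin (p + 1))) :
    removeCoord j z = WithLp.toLp 2 fun i => z (j.succAbove i) := rfl

@[simp]
theorem insertCoord_same (j : Fin (p + 1)) (q : EuclideanSpace ℝ (Fin p) × ℝ) :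
    insertCoord j q j = q.2 := by
  simp [insertCoord_apply]

@[simp]
theorem insertCoord_succAbove (j : Fin (p + 1)) (q : EuclideanSpace ℝ (Fin p) × ℝ) (i : Fin p) :
    insertCoord j q (j.succAbove i) = q.1 i := by
  simp [insertCoord_apply]

@[simp]
theorem removeCoord_apply (j : Fin (p + 1)) (z : EuclideanSpace ℝ (Fin (p + 1))) (i : Fin p) :
    removeCoord j z i = z (j.succAbove i) := rfl

@[simp]
theorem removeCoord_insertCoord (j : Fin (p + 1)) (q : EuclideanSpace ℝ (Fin p) × ℝ) :
    removeCoord j (insertCoord j q) = q.1 := by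
  ext i; simp

@[simp]
theorem insertCoord_removeCoord (j : Fin (p + 1)) (z : EuclideanSpace ℝ (Fin (p + 1))) :
    insertCoord j (removeCoord j z, z j) = z := by
  ext i
  induction i using Fin.succAboveCases j with
  | x => simp
  | p i => simp

theorem inner_insertCoord (j : Fin (p + 1)) (q : EuclideanSpace ℝ (Fin p) × ℝ)
    (z : EuclideanSpace ℝ (Fin (p + 1))) :
    inner ℝ (insertCoord j q) z = inner ℝ q.1 (removeCoord j z) + q.2 * z j := by
  simp only [PiLp.inner_apply, Fin.sum_univ_succAbove _ j, insertCoord_same, insertCoord_succAbove,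
    removeCoord_apply]
  simp [mul_comm, add_comm]

theorem measurePreserving_insertCoord (j : Fin (p + 1)) :
    MeasurePreserving (insertCoord j : EuclideanSpace ℝ (Fin p) × ℝ → _) := by
  have h1 : MeasurePreserving (Prod.map (WithLp.ofLp : EuclideanSpace ℝ (Fin p) → _) (id : ℝ → ℝ))
      volume volume := (PiLp.volume_preserving_ofLp (Fin p)).prod (MeasurePreserving.id volume)
  have h2 : MeasurePreserving (Prod.swap : (Fin p → ℝ) × ℝ → ℝ × (Fin p → ℝ)) volume volume :=
    Measure.measurePreserving_swap
  have h3 := (volume_preserving_piFinSuccAbove (fun _ : Fin (p + 1) => ℝ) j).symm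
  exact (PiLp.volume_preserving_toLp (Fin (p + 1))).comp (h3.comp (h2.comp h1))

/-- The gradient of `γ : ℝᵖ → ℝ`, as a vector of partial derivatives. -/
def gradVec (γ : EuclideanSpace ℝ (Fin p) → ℝ) (w : EuclideanSpace ℝ (Fin p)) :
    EuclideanSpace ℝ (Fin p) :=
  WithLp.toLp 2 fun i => fderiv ℝ γ w (EuclideanSpace.single i 1)

theorem inner_gradVec (γ : EuclideanSpace ℝ (Fin p) → ℝ) (w v : EuclideanSpace ℝ (Fin p)) :
    inner ℝ (gradVec γ w) v = fderiv ℝ γ w v := by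
  have hv : v = ∑ i, v i • EuclideanSpace.single i (1 : ℝ) := by
    ext k
    simp [Finset.sum_apply, Pi.single_apply]
  conv_rhs => rw [hv, map_sum]
  simp [PiLp.inner_apply, gradVec]

theorem continuous_gradVec {γ : EuclideanSpace ℝ (Fin p) → ℝ} (hγ : ContDiff ℝ 1 γ) :
    Continuous (gradVec γ) := by
  have := hγ.continuous_fderiv one_ne_zero
  unfold gradVec
  fun_prop

/-- The parametrization of the graph `z j = γ(z')`. -/
def graphMap (j : Fin (p + 1)) (γ : EuclideanSpace ℝ (Fin p) → ℝ)
    (w : EuclideanSpace ℝ (Fin p)) : EuclideanSpace ℝ (Fin (p + 1)) :=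
  insertCoord j (w, γ w)

/-- The (not normalized) upward normal `(-∇γ, 1)` of the graph of `γ`. -/
def graphNormal (j : Fin (p + 1)) (γ : EuclideanSpace ℝ (Fin p) → ℝ)
    (w : EuclideanSpace ℝ (Fin p)) : EuclideanSpace ℝ (Fin (p + 1)) :=
  insertCoord j (-gradVec γ w, 1)

theorem inner_graphNormal (j : Fin (p + 1)) (γ : EuclideanSpace ℝ (Fin p) → ℝ)
    (w : EuclideanSpace ℝ (Fin p)) (v : EuclideanSpace ℝ (Fin (p + 1))) :
    inner ℝ (graphNormal j γ w) v = v j - fderiv ℝ γ w (removeCoord j v) := by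
  rw [graphNormal, inner_insertCoord, inner_neg_left, inner_gradVec]
  ring

theorem norm_graphNormal_sq (j : Fin (p + 1)) (γ : EuclideanSpace ℝ (Fin p) → ℝ)
    (w : EuclideanSpace ℝ (Fin p)) :
    ‖graphNormal j γ w‖ ^ 2 = 1 + ∑ i, fderiv ℝ γ w (EuclideanSpace.single i 1) ^ 2 := by
  simp [EuclideanSpace.norm_sq_eq, Fin.sum_univ_succAbove _ j, graphNormal, gradVec]

theorem graphNormal_ne_zero (j : Fin (p + 1)) (γ : EuclideanSpace ℝ (Fin p) → ℝ)
    (w : EuclideanSpace ℝ (Fin p)) : graphNormal j γ w ≠ 0 := fun h => by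
  have := congrArg (fun z => z j) h
  simp [graphNormal] at this

theorem continuous_graphNormal (j : Fin (p + 1)) {γ : EuclideanSpace ℝ (Fin p) → ℝ}
    (hγ : ContDiff ℝ 1 γ) : Continuous (graphNormal j γ) := by
  have := continuous_gradVec hγ
  unfold graphNormal
  fun_prop

theorem hasStrictFDerivAt_graphMap (j : Fin (p + 1)) {γ : EuclideanSpace ℝ (Fin p) → ℝ}
    (hγ : ContDiff ℝ 1 γ) (w : EuclideanSpace ℝ (Fin p)) :
    HasStrictFDerivAt (graphMap j γ)
      ((insertCoord j).comp ((ContinuousLinearMap.id ℝ _).prod (fderiv ℝ γ w))) w :=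
  (insertCoord j).hasStrictFDerivAt.comp w
    ((hasStrictFDerivAt_id w).prodMk (hγ.contDiffAt.hasStrictFDerivAt one_ne_zero))

theorem isClosedEmbedding_graphMap (j : Fin (p + 1)) {γ : EuclideanSpace ℝ (Fin p) → ℝ}
    (hγ : Continuous γ) : IsClosedEmbedding (graphMap j γ) :=
  IsClosedEmbedding.of_continuous_injective_isClosedMap
    (by unfold graphMap; fun_prop)
    (fun a b h => by simpa [graphMap] using congrArg (removeCoord j) h)
    (fun s hs => by
      have : graphMap j γ '' s = {z | z j = γ (removeCoord j z)} ∩ removeCoord j ⁻¹' s := by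
        ext z
        constructor
        · rintro ⟨w, hw, rfl⟩
          simpa [graphMap] using hw
        · rintro ⟨h1, h2⟩
          exact ⟨removeCoord j z, h2, by rw [graphMap, ← h1, insertCoord_removeCoord]⟩
      rw [this]
      refine (isClosed_eq (by fun_prop) (by fun_prop)).inter (hs.preimage (by fun_prop)))

/-- The Gram matrix of the tangent vectors is $I+\ell\ell^T$ with $\ell=\nabla\gamma$. Its
determinant is $1+|\ell|^2$ by the rank-one determinant formula, the squared length of the normal
$(-\nabla\gamma,1)$. -/
theorem normDet_fderiv_graphMap (j : Fin (p + 1)) (γ : EuclideanSpace ℝ (Fin p) → ℝ)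
    (w : EuclideanSpace ℝ (Fin p)) :
    ((insertCoord j).comp
      ((ContinuousLinearMap.id ℝ _).prod (fderiv ℝ γ w))).toLinearMap.normDet =
      ‖graphNormal j γ w‖ := by
  rw [← sq_eq_sq₀ (LinearMap.normDet_nonneg _) (norm_nonneg _), norm_graphNormal_sq]
  have h := LinearMap.normDet_sq_eq_det_gram ((insertCoord j).comp
    ((ContinuousLinearMap.id ℝ _).prod (fderiv ℝ γ w))).toLinearMap
    (EuclideanSpace.basisFun (Fin p) ℝ)
  set ℓ : Fin p → ℝ := fun i => fderiv ℝ γ w (EuclideanSpace.single i 1)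
  have hM : Matrix.gram ℝ (fun i => ((insertCoord j).comp
      ((ContinuousLinearMap.id ℝ _).prod (fderiv ℝ γ w))).toLinearMap
        (EuclideanSpace.basisFun (Fin p) ℝ i)) =
      1 + Matrix.replicateCol Unit ℓ * Matrix.replicateRow Unit ℓ := by
    ext i k
    simp [Matrix.gram_apply, inner_insertCoord, Matrix.mul_apply, Matrix.one_apply, ℓ,
      EuclideanSpace.inner_single_left]
  rw [hM, Matrix.det_one_add_replicateCol_mul_replicateRow] at h
  simpa [dotProduct, sq] using h

theorem comap_graphMap_euclideanHausdorffMeasure (j : Fin (p + 1))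
    {γ : EuclideanSpace ℝ (Fin p) → ℝ} (hγ : ContDiff ℝ 1 γ) :
    (Measure.euclideanHausdorffMeasure p).comap (graphMap j γ) =
      volume.withDensity fun w => ENNReal.ofReal ‖graphNormal j γ w‖ := by
  have h := comap_euclideanHausdorffMeasure_eq_withDensity
    (fun w => hasStrictFDerivAt_graphMap j hγ w)
    (isClosedEmbedding_graphMap j hγ.continuous).measurableEmbedding
    (fun w a b h => by simpa using congrArg (removeCoord j) h)
  rw [finrank_euclideanSpace_fin] at h
  rw [h]
  simp only [normDet_fderiv_graphMap]

theorem integrableOn_range_graphMap_iff {E : Type*} [NormedAddCommGroup E] [NormedSpace ℝ E]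
    (j : Fin (p + 1)) {γ : EuclideanSpace ℝ (Fin p) → ℝ} (hγ : ContDiff ℝ 1 γ)
    (F : EuclideanSpace ℝ (Fin (p + 1)) → E) :
    IntegrableOn F (Set.range (graphMap j γ)) (Measure.euclideanHausdorffMeasure p) ↔
      Integrable fun w => ‖graphNormal j γ w‖ • F (graphMap j γ w) := by
  have he := (isClosedEmbedding_graphMap j hγ.continuous).measurableEmbedding
  have hm : Measurable fun w => ‖graphNormal j γ w‖₊ :=
    (continuous_graphNormal j hγ).nnnorm.measurable
  have h2 := integrable_withDensity_iff_integrable_smul (μ := volume) hm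
    (g := F ∘ graphMap j γ)
  rw [IntegrableOn, ← he.map_comap, he.integrable_map_iff,
    comap_graphMap_euclideanHausdorffMeasure j hγ]
  simpa [ofReal_norm, NNReal.smul_def] using! h2

theorem setIntegral_range_graphMap {E : Type*} [NormedAddCommGroup E] [NormedSpace ℝ E]
    (j : Fin (p + 1)) {γ : EuclideanSpace ℝ (Fin p) → ℝ} (hγ : ContDiff ℝ 1 γ)
    (F : EuclideanSpace ℝ (Fin (p + 1)) → E) :
    ∫ y in Set.range (graphMap j γ), F y ∂(Measure.euclideanHausdorffMeasure p) =
      ∫ w, ‖graphNormal j γ w‖ • F (graphMap j γ w) := by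
  have he := (isClosedEmbedding_graphMap j hγ.continuous).measurableEmbedding
  have hm : Measurable fun w => ‖graphNormal j γ w‖₊ :=
    (continuous_graphNormal j hγ).nnnorm.measurable
  have h2 := integral_withDensity_eq_integral_smul (μ := volume) hm (F ∘ graphMap j γ)
  rw [← he.map_comap, he.integral_map, comap_graphMap_euclideanHausdorffMeasure j hγ]
  simpa [ofReal_norm, NNReal.smul_def] using! h2

end Graph

/-! ### The divergence theorem for compactly supported fields. -/

section WeakDivergence

variable {E : Type*} [NormedAddCommGroup E] [NormedSpace ℝ E] {p : ℕ}

/-- The integral of the divergence of a compactly supported differentiable vector field vanishes. -/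
theorem integral_divergence_eq_zero_of_hasCompactSupport
    {F : Fin (p + 1) → EuclideanSpace ℝ (Fin (p + 1)) → E}
    (hF : ∀ i, Differentiable ℝ (F i)) (hc : ∀ i, HasCompactSupport (F i))
    (hint : Integrable fun y => ∑ i, fderiv ℝ (F i) y (EuclideanSpace.single i 1)) :
    ∫ y, ∑ i, fderiv ℝ (F i) y (EuclideanSpace.single i 1) = 0 := by
  obtain ⟨R, hR0, hR⟩ : ∃ R : ℝ, 0 < R ∧ ∀ i, ∀ z ∈ tsupport (F i), ‖z‖ < R := by
    have hb : Bornology.IsBounded (⋃ i, tsupport (F i)) :=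
      Bornology.isBounded_iUnion.2 fun i => (hc i).isCompact.isBounded
    obtain ⟨R, hR0, hR⟩ := hb.exists_pos_norm_lt
    exact ⟨R, hR0, fun i z hz => hR z (Set.mem_iUnion.2 ⟨i, hz⟩)⟩
  have hzero : ∀ i z, R ≤ ‖z‖ → F i z = 0 := fun i z hz =>
    image_eq_zero_of_notMem_tsupport fun h => absurd (hR i z h) (not_lt.2 hz)
  have hzero' : ∀ i z, R ≤ ‖z‖ → fderiv ℝ (F i) z = 0 := fun i z hz => by
    by_contra h
    exact absurd (hR i z (support_fderiv_subset ℝ h)) (not_lt.2 hz)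
  let L : (Fin (p + 1) → ℝ) ≃L[ℝ] EuclideanSpace ℝ (Fin (p + 1)) :=
    (PiLp.continuousLinearEquiv 2 ℝ fun _ => ℝ).symm
  have hLe : ∀ i : Fin (p + 1), L (Pi.single i 1) = EuclideanSpace.single i 1 := fun _ => rfl
  have hcoord : ∀ (x : Fin (p + 1) → ℝ) i, |x i| ≤ ‖L x‖ := fun x i =>
    PiLp.norm_apply_le (L x) i
  have hmp : MeasurePreserving L := PiLp.volume_preserving_toLp (Fin (p + 1))
  have hme : MeasurableEmbedding L := L.toHomeomorph.measurableEmbedding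
  set d : EuclideanSpace ℝ (Fin (p + 1)) → E :=
    fun y => ∑ i, fderiv ℝ (F i) y (EuclideanSpace.single i 1)
  let L' : (Fin (p + 1) → ℝ) →L[ℝ] EuclideanSpace ℝ (Fin (p + 1)) := L
  have hdL : ∀ x, (∑ i, ((fderiv ℝ (F i) (L x)).comp L') (Pi.single i 1)) = d (L x) :=
    fun x => by simp [d, L', hLe]
  -- This form of the theorem on a box asks for differentiability and an integrable divergence, not
  -- for continuous derivatives. The box contains all supports, so the face terms vanish.
  have key := integral_divergence_of_hasFDerivAt_off_countable'
    (fun _ : Fin (p + 1) => -R) (fun _ => R) (fun i => by simp; linarith)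
    (fun i x => F i (L x)) (fun i x => (fderiv ℝ (F i) (L x)).comp L') ∅
    Set.countable_empty
    (fun i => ((hF i).continuous.comp L.continuous).continuousOn)
    (fun x _ i => ((hF i) (L x)).hasFDerivAt.comp x L.hasFDerivAt)
    (by
      simp only [hdL]
      exact ((hmp.integrable_comp_emb hme).2 hint).integrableOn)
  simp only [hdL] at key
  rw [setIntegral_eq_integral_of_forall_compl_eq_zero, hmp.integral_comp hme] at key
  · rw [key]
    refine Finset.sum_eq_zero fun i _ => ?_
    have hface : ∀ c : ℝ, |c| = R → ∀ x : Fin p → ℝ, F i (L (i.insertNth c x)) = 0 :=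
      fun c hcR x => hzero i _ (by simpa [hcR] using hcoord (i.insertNth c x) i)
    have h1 := hface R (abs_of_pos hR0)
    have h2 := hface (-R) (by rw [abs_neg, abs_of_pos hR0])
    simp [h1, h2]
  · intro x hx
    have : ∃ i, R < |x i| := by
      by_contra! h
      exact hx ⟨fun i => (abs_le.1 (h i)).1, fun i => (abs_le.1 (h i)).2⟩
    obtain ⟨i, hi⟩ := this
    exact Finset.sum_eq_zero fun k _ => by
      rw [hzero' k _ (hi.le.trans (hcoord x i)), _root_.zero_apply]

variable {D : Set (EuclideanSpace ℝ (Fin (p + 1)))}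
  {G : Fin (p + 1) → EuclideanSpace ℝ (Fin (p + 1)) → E} {g : EuclideanSpace ℝ (Fin (p + 1)) → E}

/-- The divergence identity `div G = g` on `D`, tested against a compactly supported function. -/
theorem integral_fderiv_smul_add_smul_eq_zero (hD : IsOpen D) (hG : ∀ i, Continuous (G i))
    (hg : Continuous g) (hGd : ∀ i, DifferentiableOn ℝ (G i) D)
    (hdiv : ∀ y ∈ D, ∑ i, fderiv ℝ (G i) y (EuclideanSpace.single i 1) = g y)
    {φ : EuclideanSpace ℝ (Fin (p + 1)) → ℝ} (hφ : ContDiff ℝ 1 φ) (hφc : HasCompactSupport φ)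
    (hφD : tsupport φ ⊆ D) :
    ∫ y, ((∑ i, fderiv ℝ φ y (EuclideanSpace.single i 1) • G i y) + φ y • g y) = 0 := by
  have hφd : Differentiable ℝ φ := hφ.differentiable one_ne_zero
  have hφ' := hφ.continuous_fderiv one_ne_zero
  -- `G i` may fail to be differentiable outside `D`, but there the product vanishes near each
  -- point.
  have hdiff : ∀ i, Differentiable ℝ fun y => φ y • G i y := fun i y => by
    by_cases hy : y ∈ tsupport φ
    · exact (hφd y).smul ((hGd i).differentiableAt (hD.mem_nhds (hφD hy)))
    · have : (fun y => φ y • G i y) =ᶠ[𝓝 y] fun _ => 0 := by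
        filter_upwards [notMem_tsupport_iff_eventuallyEq.1 hy] with z hz
        simp [hz]
      exact (differentiableAt_const (0 : E)).congr_of_eventuallyEq this
  have heq : ∀ y, ∑ i, fderiv ℝ (fun y => φ y • G i y) y (EuclideanSpace.single i 1) =
      (∑ i, fderiv ℝ φ y (EuclideanSpace.single i 1) • G i y) + φ y • g y := fun y => by
    by_cases hy : y ∈ tsupport φ
    · rw [← hdiv y (hφD hy), Finset.smul_sum, ← Finset.sum_add_distrib]
      refine Finset.sum_congr rfl fun i _ => ?_
      rw [fderiv_fun_smul (hφd y) ((hGd i).differentiableAt (hD.mem_nhds (hφD hy)))]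
      simp [add_comm]
    · have h0 := notMem_tsupport_iff_eventuallyEq.1 hy
      have h1 : ∀ i, fderiv ℝ (fun y => φ y • G i y) y = 0 := fun i => by
        have : (fun y => φ y • G i y) =ᶠ[𝓝 y] fun _ => 0 := by
          filter_upwards [h0] with z hz
          simp [hz]
        rw [this.fderiv_eq, fderiv_fun_const]; rfl
      have h2 : fderiv ℝ φ y = 0 := by
        rw [h0.fderiv_eq, fderiv_zero]; rfl
      simp [h1, h2, h0.eq_of_nhds]
  have hcs : HasCompactSupport
      fun y => (∑ i, fderiv ℝ φ y (EuclideanSpace.single i 1) • G i y) + φ y • g y := by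
    refine HasCompactSupport.intro hφc fun y hy => ?_
    have h2 : fderiv ℝ φ y = 0 := by
      by_contra h
      exact hy (support_fderiv_subset ℝ h)
    simp [h2, image_eq_zero_of_notMem_tsupport hy]
  have hcont : Continuous
      fun y => (∑ i, fderiv ℝ φ y (EuclideanSpace.single i 1) • G i y) + φ y • g y := by
    have := hφ.continuous
    fun_prop
  have := integral_divergence_eq_zero_of_hasCompactSupport hdiff (fun i => hφc.smul_right)
    (by simp only [heq]; exact hcont.integrable_of_hasCompactSupport hcs)
  simpa only [heq] using this

end WeakDivergence

/-! ### Straightening a graph and concentrating layers on it. -/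

section GraphChart

variable {E : Type*} [NormedAddCommGroup E] [NormedSpace ℝ E] [CompleteSpace E] {p : ℕ}

/-- The signed height of `z` below (`s = 1`) or above (`s = -1`) the graph of `γ`. -/
def graphHeight (j : Fin (p + 1)) (s : ℝ) (γ : EuclideanSpace ℝ (Fin p) → ℝ)
    (z : EuclideanSpace ℝ (Fin (p + 1))) : ℝ :=
  s * (γ (removeCoord j z) - z j)

theorem hasFDerivAt_graphHeight (j : Fin (p + 1)) (s : ℝ) {γ : EuclideanSpace ℝ (Fin p) → ℝ}
    (hγ : ContDiff ℝ 1 γ) (z : EuclideanSpace ℝ (Fin (p + 1))) :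
    HasFDerivAt (graphHeight j s γ) (-(s • innerSL ℝ (graphNormal j γ (removeCoord j z)))) z := by
  have h1 : HasFDerivAt (fun z => γ (removeCoord j z)) _ z :=
    (hγ.differentiable one_ne_zero _).hasFDerivAt.comp z (removeCoord j).hasFDerivAt
  have h2 : HasFDerivAt (fun z : EuclideanSpace ℝ (Fin (p + 1)) => z j)
      (EuclideanSpace.proj j : EuclideanSpace ℝ (Fin (p + 1)) →L[ℝ] ℝ) z :=
    (EuclideanSpace.proj j : EuclideanSpace ℝ (Fin (p + 1)) →L[ℝ] ℝ).hasFDerivAt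
  refine ((h1.sub h2).const_mul s).congr_fderiv ?_
  ext v
  simp [inner_graphNormal]
  ring

theorem contDiff_graphHeight (j : Fin (p + 1)) (s : ℝ) {γ : EuclideanSpace ℝ (Fin p) → ℝ}
    {n : ℕ∞ω} (hγ : ContDiff ℝ n γ) : ContDiff ℝ n (graphHeight j s γ) := by
  unfold graphHeight
  fun_prop

/-- Straightening of the graph of `γ`: a pair `(w, t)` is mapped to the point above `w` of height
`t`. -/
def graphChart (j : Fin (p + 1)) {s : ℝ} (hs : s * s = 1) {γ : EuclideanSpace ℝ (Fin p) → ℝ}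
    (hγ : Continuous γ) : (EuclideanSpace ℝ (Fin p) × ℝ) ≃ₜ EuclideanSpace ℝ (Fin (p + 1)) where
  toFun q := insertCoord j (q.1, γ q.1 - s * q.2)
  invFun z := (removeCoord j z, graphHeight j s γ z)
  left_inv q := by
    ext1
    · simp
    · simp [graphHeight, ← mul_assoc, hs]
  right_inv z := by
    simp [graphHeight, ← mul_assoc, hs]
  continuous_toFun := by fun_prop
  continuous_invFun := by unfold graphHeight; fun_prop

theorem graphChart_apply (j : Fin (p + 1)) {s : ℝ} (hs : s * s = 1)
    {γ : EuclideanSpace ℝ (Fin p) → ℝ} (hγ : Continuous γ) (q : EuclideanSpace ℝ (Fin p) × ℝ) :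
    graphChart j hs hγ q = insertCoord j (q.1, γ q.1 - s * q.2) := rfl

theorem graphHeight_graphChart (j : Fin (p + 1)) {s : ℝ} (hs : s * s = 1)
    {γ : EuclideanSpace ℝ (Fin p) → ℝ} (hγ : Continuous γ) (q : EuclideanSpace ℝ (Fin p) × ℝ) :
    graphHeight j s γ (graphChart j hs hγ q) = q.2 :=
  congrArg Prod.snd ((graphChart j hs hγ).symm_apply_apply q)

/-- The chart is a shear followed by a permutation of coordinates: on each fibre it is
$t\mapsto\gamma(w)-st$ with $s=\pm1$, which preserves Lebesgue measure. -/
theorem measurePreserving_graphChart (j : Fin (p + 1)) {s : ℝ} (hs : s * s = 1)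
    {γ : EuclideanSpace ℝ (Fin p) → ℝ} (hγ : Continuous γ) :
    MeasurePreserving (graphChart j hs hγ) := by
  have hmul : MeasurePreserving (fun t : ℝ => s * t) := by
    rcases mul_self_eq_one_iff.1 hs with rfl | rfl
    · simpa [Function.id_def] using MeasurePreserving.id (volume : Measure ℝ)
    · simpa using Measure.measurePreserving_neg (volume : Measure ℝ)
  have hshear : MeasurePreserving
      (fun q : EuclideanSpace ℝ (Fin p) × ℝ => (q.1, γ q.1 - s * q.2)) :=
    (MeasurePreserving.id volume).skew_product (g := fun w t => γ w - s * t)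
      (by have := hγ.measurable; unfold Function.uncurry; fun_prop)
      (ae_of_all _ fun w =>
        ((Measure.measurePreserving_sub_left volume (γ w)).comp hmul).map_eq)
  exact (measurePreserving_insertCoord j).comp hshear

/-- Mollified layers around a graph concentrate on the graph. -/
theorem tendsto_integral_layer (j : Fin (p + 1)) {s : ℝ} (hs : s * s = 1)
    {γ : EuclideanSpace ℝ (Fin p) → ℝ} (hγ : Continuous γ) {ψ : ℝ → ℝ} (hψ : Continuous ψ)
    (hψc : HasCompactSupport ψ) {κ : EuclideanSpace ℝ (Fin (p + 1)) → E} (hκ : Continuous κ)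
    (hκc : HasCompactSupport κ) :
    Tendsto (fun ε : ℝ => ∫ z, (ε⁻¹ * ψ (graphHeight j s γ z / ε)) • κ z) (𝓝[>] 0)
      (𝓝 ((∫ t, ψ t) • ∫ w, κ (graphMap j γ w))) := by
  set Ψ := graphChart j hs hγ
  set k : EuclideanSpace ℝ (Fin p) × ℝ → E := fun q => κ (Ψ q)
  have hk : Continuous k := hκ.comp Ψ.continuous
  have hkc : HasCompactSupport k := hκc.comp_isClosedEmbedding Ψ.isClosedEmbedding
  set Q : ℝ → E := fun t => ∫ w, k (w, t)
  have hQ : Continuous Q := by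
    rw [← continuousOn_univ]
    refine continuousOn_integral_of_compact_support (f := fun t w => k (w, t))
      (hkc.isCompact.image continuous_fst)
      (by unfold Function.uncurry; fun_prop) fun t w _ hw => ?_
    exact image_eq_zero_of_notMem_tsupport fun h => hw ⟨_, h, rfl⟩
  have hQc : HasCompactSupport Q := by
    refine HasCompactSupport.intro (hkc.isCompact.image continuous_snd) fun t ht => ?_
    have : ∀ w, k (w, t) = 0 := fun w =>
      image_eq_zero_of_notMem_tsupport fun h => ht ⟨_, h, rfl⟩
    simp [Q, this]
  have hQ0 : Q 0 = ∫ w, κ (graphMap j γ w) := by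
    simp [Q, k, Ψ, graphChart_apply, graphMap]
  -- In the chart the height is the coordinate `t`. Fubini and the substitution of `ε * t` for `t`
  -- absorb the factor `ε⁻¹`.
  have hε : ∀ ε > 0, ∫ z, (ε⁻¹ * ψ (graphHeight j s γ z / ε)) • κ z =
      ∫ t, ψ t • Q (ε * t) := by
    intro ε hε
    rw [← (measurePreserving_graphChart j hs hγ).integral_comp Ψ.measurableEmbedding]
    simp only [graphHeight_graphChart]
    rw [Measure.volume_eq_prod, integral_prod_symm]
    · have h1 := Measure.integral_comp_mul_left (fun t => (ε⁻¹ * ψ (t / ε)) • Q t) ε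
      have h2 : ∀ t, (ε⁻¹ * ψ (ε * t / ε)) • Q (ε * t) = ε⁻¹ • (ψ t • Q (ε * t)) := fun t => by
        rw [mul_div_cancel_left₀ _ hε.ne', smul_smul]
      simp only [h2, integral_smul, abs_of_pos (inv_pos.2 hε)] at h1
      have h3 := smul_right_injective E (inv_pos.2 hε).ne' h1
      rw [h3]
      refine integral_congr_ae (ae_of_all _ fun t => ?_)
      simp only [Q, k, Ψ]
      rw [← integral_smul]
    · refine Continuous.integrable_of_hasCompactSupport (by fun_prop) ?_
      exact hkc.smul_left (f := fun q : EuclideanSpace ℝ (Fin p) × ℝ => ε⁻¹ * ψ (q.2 / ε))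
  rw [← hQ0, ← integral_smul_const]
  refine Tendsto.congr' (f₁ := fun ε => ∫ t, ψ t • Q (ε * t)) ?_ ?_
  · filter_upwards [self_mem_nhdsWithin] with ε h using (hε ε h).symm
  obtain ⟨C, hC⟩ := hQ.bounded_above_of_compact_support hQc
  refine tendsto_integral_filter_of_dominated_convergence (fun t => ‖ψ t‖ * C)
    (Eventually.of_forall fun ε => by
      have : Continuous fun t => ψ t • Q (ε * t) := by fun_prop
      exact this.aestronglyMeasurable)
    (Eventually.of_forall fun ε => ae_of_all _ fun t => ?_)
    ((hψ.integrable_of_hasCompactSupport hψc).norm.mul_const C) (ae_of_all _ fun t => ?_)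
  · rw [norm_smul]
    gcongr
    exact hC _
  · have : Continuous fun ε : ℝ => ψ t • Q (ε * t) := by fun_prop
    simpa using (this.tendsto 0).mono_left nhdsWithin_le_nhds

end GraphChart

/-! ### Gauss's formula on one side of a graph. -/

section ChartDivergence

variable {E : Type*} [NormedAddCommGroup E] [NormedSpace ℝ E] [CompleteSpace E] {p : ℕ}
  {D : Set (EuclideanSpace ℝ (Fin (p + 1)))}
  {G : Fin (p + 1) → EuclideanSpace ℝ (Fin (p + 1)) → E} {g : EuclideanSpace ℝ (Fin (p + 1)) → E}

/-- Gauss's formula, localized in a chart in which the domain is one side of a graph. -/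
theorem setIntegral_fderiv_smul_add_smul_eq_of_graph (hD : IsOpen D) (hG : ∀ i, Continuous (G i))
    (hg : Continuous g) (hGd : ∀ i, DifferentiableOn ℝ (G i) D)
    (hdiv : ∀ y ∈ D, ∑ i, fderiv ℝ (G i) y (EuclideanSpace.single i 1) = g y)
    {j : Fin (p + 1)} {s : ℝ} (hs : s * s = 1) {γ : EuclideanSpace ℝ (Fin p) → ℝ}
    (hγ : ContDiff ℝ 1 γ) {U : Set (EuclideanSpace ℝ (Fin (p + 1)))}
    (hU : ∀ z ∈ U, z ∈ D ↔ 0 < graphHeight j s γ z)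
    {χ : EuclideanSpace ℝ (Fin (p + 1)) → ℝ} (hχ : ContDiff ℝ 1 χ) (hχc : HasCompactSupport χ)
    (hχU : tsupport χ ⊆ U) :
    ∫ y in D, ((∑ i, fderiv ℝ χ y (EuclideanSpace.single i 1) • G i y) + χ y • g y) =
      ∫ w, χ (graphMap j γ w) • ∑ i, (s * graphNormal j γ w i) • G i (graphMap j γ w) := by
  -- Since `h` vanishes up to 1, the test function $\chi\,h(\tau/\varepsilon)$ is supported where
  -- $\tau\ge\varepsilon$, hence inside `D`. Since `h` is 1 from 2 on, it tends to $\chi$ on `D`.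
  set h : ℝ → ℝ := fun t => Real.smoothTransition (t - 1)
  have hhd : ContDiff ℝ ∞ h := Real.smoothTransition.contDiff.comp (by fun_prop)
  have hhc : Continuous (deriv h) := hhd.continuous_deriv (by simp)
  have hh0 : ∀ t ≤ 1, h t = 0 := fun t ht =>
    Real.smoothTransition.zero_of_nonpos (by linarith)
  have hh1 : ∀ t, 2 ≤ t → h t = 1 := fun t ht =>
    Real.smoothTransition.one_of_one_le (by linarith)
  have hsupp : ∀ t, t ∉ Set.Icc (1 : ℝ) 2 → deriv h t = 0 := by
    intro t ht
    rw [Set.mem_Icc, not_and_or, not_le, not_le] at ht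
    rcases ht with ht | ht
    · have : h =ᶠ[𝓝 t] fun _ => 0 := by
        filter_upwards [Iio_mem_nhds ht] with u hu using hh0 u (le_of_lt hu)
      rw [this.deriv_eq, deriv_const]
    · have : h =ᶠ[𝓝 t] fun _ => 1 := by
        filter_upwards [Ioi_mem_nhds ht] with u hu using hh1 u (le_of_lt hu)
      rw [this.deriv_eq, deriv_const]
  have hhcs : HasCompactSupport (deriv h) := HasCompactSupport.intro isCompact_Icc hsupp
  have hint : ∫ t, deriv h t = 1 := by
    rw [← setIntegral_eq_integral_of_forall_compl_eq_zero (s := Set.Icc 1 2) hsupp,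
      integral_Icc_eq_integral_Ioc, ← intervalIntegral.integral_of_le (by norm_num),
      intervalIntegral.integral_deriv_eq_sub
        (fun t _ => hhd.differentiable (by simp) t) (hhc.intervalIntegrable _ _),
      hh0 1 le_rfl, hh1 2 le_rfl, sub_zero]
  set τ := graphHeight j s γ
  have hτd : ContDiff ℝ 1 τ := contDiff_graphHeight j s hγ
  set N : EuclideanSpace ℝ (Fin (p + 1)) → EuclideanSpace ℝ (Fin (p + 1)) :=
    fun z => graphNormal j γ (removeCoord j z)
  have hN : Continuous N := (continuous_graphNormal j hγ).comp (removeCoord j).continuous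
  have hχ' := hχ.continuous_fderiv one_ne_zero
  have hχ0 := hχ.continuous
  set R : EuclideanSpace ℝ (Fin (p + 1)) → E :=
    fun y => (∑ i, fderiv ℝ χ y (EuclideanSpace.single i 1) • G i y) + χ y • g y
  set κ : EuclideanSpace ℝ (Fin (p + 1)) → E := fun y => χ y • ∑ i, (s * N y i) • G i y
  have hRc : Continuous R := by fun_prop
  have hR0 : ∀ y ∉ tsupport χ, R y = 0 := fun y hy => by
    have h2 : fderiv ℝ χ y = 0 := by
      by_contra h
      exact hy (support_fderiv_subset ℝ h)
    simp [R, h2, image_eq_zero_of_notMem_tsupport hy]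
  have hRi : Integrable R :=
    hRc.integrable_of_hasCompactSupport (HasCompactSupport.intro hχc hR0)
  have hκc : Continuous κ := by fun_prop
  have hκcs : HasCompactSupport κ := hχc.smul_right
  -- The weak identity is expanded by the product rule. The gradient of the height is `-s • N`, so
  -- the derivative falling on `h` produces a layer with the flux density `κ`.
  have htest : ∀ ε > 0, (∫ y, h (τ y / ε) • R y) =
      ∫ z, (ε⁻¹ * deriv h (τ z / ε)) • κ z := by
    intro ε hε
    have hφ : ContDiff ℝ 1 fun y => χ y * h (τ y / ε) :=
      hχ.mul ((hhd.of_le (by simp)).comp (hτd.div_const ε))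
    have hsub : tsupport (fun y => χ y * h (τ y / ε)) ⊆ tsupport χ ∩ {y | ε ≤ τ y} := by
      refine closure_minimal (fun y hy => ?_)
        ((isClosed_tsupport χ).inter (isClosed_le continuous_const hτd.continuous))
      have h1 := left_ne_zero_of_mul hy
      have h2 := right_ne_zero_of_mul hy
      refine ⟨subset_tsupport χ h1, ?_⟩
      by_contra h3
      exact h2 (hh0 _ ((div_le_one hε).2 (le_of_not_ge h3)))
    have key := integral_fderiv_smul_add_smul_eq_zero hD hG hg hGd hdiv hφ hχc.mul_right
      (fun y hy => (hU y (hχU (hsub hy).1)).2 (hε.trans_le (hsub hy).2))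
    have hfd : ∀ y v, fderiv ℝ (fun y => χ y * h (τ y / ε)) y v =
        h (τ y / ε) * fderiv ℝ χ y v -
          χ y * (ε⁻¹ * deriv h (τ y / ε)) * (s * inner ℝ (N y) v) := by
      intro y v
      have h0 : HasFDerivAt (fun y => τ y / ε) _ y :=
        (hasFDerivAt_graphHeight j s hγ y).mul_const ε⁻¹
      have hd : HasDerivAt h (deriv h (τ y / ε)) (τ y / ε) :=
        (hhd.differentiable (by simp) (τ y / ε)).hasDerivAt
      have h1 := hd.comp_hasFDerivAt y h0
      simp only [Function.comp_def] at h1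
      rw [(((hχ.differentiable one_ne_zero y).hasFDerivAt).fun_mul h1).fderiv]
      simp [N]
      ring
    have hpt : ∀ y, (∑ i, fderiv ℝ (fun y => χ y * h (τ y / ε)) y (EuclideanSpace.single i 1) •
        G i y) + (χ y * h (τ y / ε)) • g y =
        h (τ y / ε) • R y - (ε⁻¹ * deriv h (τ y / ε)) • κ y := by
      intro y
      simp only [hfd, R, κ, smul_add, Finset.smul_sum, sub_smul, Finset.sum_sub_distrib, smul_smul,
        EuclideanSpace.inner_single_right]
      have e1 : ∀ i, χ y * (ε⁻¹ * deriv h (τ y / ε)) * (s * (1 * (starRingEnd ℝ) (N y i))) =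
        ε⁻¹ * deriv h (τ y / ε) * (χ y * (s * N y i)) := fun i => by simp; ring
      simp only [e1, mul_comm (χ y) (h _)]
      abel
    simp only [hpt] at key
    rw [integral_sub, sub_eq_zero] at key
    · exact key
    · refine Continuous.integrable_of_hasCompactSupport (by fun_prop) ?_
      exact (HasCompactSupport.intro hχc hR0).smul_left
    · refine Continuous.integrable_of_hasCompactSupport (by fun_prop) ?_
      exact hκcs.smul_left
  have hlim1 : Tendsto (fun ε : ℝ => ∫ y, h (τ y / ε) • R y) (𝓝[>] 0) (𝓝 (∫ y in D, R y)) := by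
    rw [← integral_indicator hD.measurableSet]
    refine tendsto_integral_filter_of_dominated_convergence (fun y => ‖R y‖)
      (Eventually.of_forall fun ε => ?_) (Eventually.of_forall fun ε => ae_of_all _ fun y => ?_)
      hRi.norm (ae_of_all _ fun y => ?_)
    · exact (Continuous.smul (by fun_prop) hRc).aestronglyMeasurable
    · rw [norm_smul]
      refine mul_le_of_le_one_left (norm_nonneg _) ?_
      rw [Real.norm_of_nonneg (Real.smoothTransition.nonneg _)]
      exact Real.smoothTransition.le_one _
    · by_cases hy : y ∈ tsupport χ
      · by_cases hyD : y ∈ D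
        · have hpos := (hU y (hχU hy)).1 hyD
          rw [Set.indicator_of_mem hyD]
          refine tendsto_const_nhds.congr' ?_
          filter_upwards [Ioc_mem_nhdsGT (half_pos hpos)] with ε hε
          rw [hh1, one_smul]
          rw [le_div_iff₀ hε.1]
          linarith [hε.2]
        · have hneg := not_lt.1 (fun hp => hyD ((hU y (hχU hy)).2 hp))
          rw [Set.indicator_of_notMem hyD]
          refine tendsto_const_nhds.congr' ?_
          filter_upwards [self_mem_nhdsWithin] with ε hε
          rw [hh0, zero_smul]
          exact (div_nonpos_of_nonpos_of_nonneg hneg (le_of_lt hε)).trans zero_le_one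
      · have : D.indicator R y = 0 := by
          simp [Set.indicator, hR0 y hy]
        simp [hR0 y hy, this]
  have hlim2 := tendsto_integral_layer j hs hγ.continuous hhc hhcs hκc hκcs
  rw [hint, one_smul] at hlim2
  have := tendsto_nhds_unique hlim1 (hlim2.congr' (by
    filter_upwards [self_mem_nhdsWithin] with ε hε using (htest ε hε).symm))
  rw [this]
  simp [κ, N, graphMap]

end ChartDivergence

/-! ### Gauss's theorem on smooth bounded domains. -/

section Gauss

variable {p : ℕ} {D : Set (EuclideanSpace ℝ (Fin (p + 1)))}

section Boundary

variable {j : Fin (p + 1)} {s : ℝ} {γ : EuclideanSpace ℝ (Fin p) → ℝ}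
  {U : Set (EuclideanSpace ℝ (Fin (p + 1)))} {y : EuclideanSpace ℝ (Fin (p + 1))}

theorem graphHeight_eq_zero_iff (hs : s * s = 1) :
    graphHeight j s γ y = 0 ↔ graphMap j γ (removeCoord j y) = y := by
  have hs0 : s ≠ 0 := fun h => by simp [h] at hs
  rw [graphHeight, mul_eq_zero_iff_left hs0, sub_eq_zero, graphMap]
  constructor
  · intro h
    rw [h, insertCoord_removeCoord]
  · intro h
    have := congrArg (fun z => z j) h
    simpa using this

/-- A point of negative height has a neighbourhood missing `D`, and a point of height zero is
approached from inside `D` along its vertical line. -/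
theorem mem_frontier_iff_graphHeight_eq_zero (hD : IsOpen D) (hs : s * s = 1) (hγ : Continuous γ)
    (hUo : IsOpen U) (hU : ∀ z ∈ U, z ∈ D ↔ 0 < graphHeight j s γ z) (hy : y ∈ U) :
    y ∈ frontier D ↔ graphHeight j s γ y = 0 := by
  have hτ : Continuous (graphHeight j s γ) := by unfold graphHeight; fun_prop
  rw [hD.frontier_eq, Set.mem_sdiff, hU y hy, not_lt]
  constructor
  · rintro ⟨hcl, hle⟩
    refine le_antisymm hle (not_lt.1 fun hlt => ?_)
    obtain ⟨z, ⟨hzU, hz0⟩, hzD⟩ := mem_closure_iff.1 hcl (U ∩ {z | graphHeight j s γ z < 0})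
      (hUo.inter (isOpen_lt hτ continuous_const)) ⟨hy, hlt⟩
    exact lt_asymm hz0 ((hU z hzU).1 hzD)
  · intro h0
    refine ⟨?_, h0.le⟩
    have hc : Tendsto (fun t : ℝ => graphChart j hs hγ (removeCoord j y, t)) (𝓝[>] 0) (𝓝 y) := by
      have h1 : Continuous fun t : ℝ => graphChart j hs hγ (removeCoord j y, t) := by fun_prop
      have h2 : graphChart j hs hγ (removeCoord j y, 0) = y := by
        rw [← h0]
        exact (graphChart j hs hγ).apply_symm_apply y
      simpa [h2] using (h1.tendsto 0).mono_left nhdsWithin_le_nhds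
    refine mem_closure_of_tendsto hc ?_
    filter_upwards [hc.eventually (hUo.mem_nhds hy), self_mem_nhdsWithin] with t ht ht0
    rw [hU _ ht, graphHeight_graphChart]
    exact ht0

/-- Let `n` be the normalized `s • N`. If `v ≠ n`, the direction `n - v` makes an obtuse angle with
`v`, so it enters `D`. It makes an acute angle with `n`, so the height decreases from zero along it,
which leaves `D`. -/
theorem norm_smul_eq_of_isOutwardUnitNormal (hs : s * s = 1) (hγ : ContDiff ℝ 1 γ)
    (hUo : IsOpen U) (hU : ∀ z ∈ U, z ∈ D ↔ 0 < graphHeight j s γ z) (hy : y ∈ U)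
    (hy0 : graphHeight j s γ y = 0) {v : EuclideanSpace ℝ (Fin (p + 1))}
    (hv : IsOutwardUnitNormal D y v) :
    ‖graphNormal j γ (removeCoord j y)‖ • v = s • graphNormal j γ (removeCoord j y) := by
  set N := graphNormal j γ (removeCoord j y)
  have hN : 0 < ‖N‖ := norm_pos_iff.2 (graphNormal_ne_zero _ _ _)
  have hs1 : ‖s‖ = 1 := by
    rcases mul_self_eq_one_iff.1 hs with rfl | rfl <;> simp
  set n := ‖N‖⁻¹ • s • N with hn
  have hn1 : ‖n‖ = 1 := by
    rw [hn, norm_smul, norm_smul, hs1, one_mul, norm_inv, norm_norm, inv_mul_cancel₀ hN.ne']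
  have hNn : s • N = ‖N‖ • n := by
    rw [hn, smul_smul, mul_inv_cancel₀ hN.ne', one_smul]
  suffices v = n by rw [hNn, this]
  by_contra hne
  have hlt : inner ℝ v n < 1 := (inner_lt_one_iff_real_of_norm_eq_one hv.1 hn1).2 hne
  set w := n - v
  have h1 : inner ℝ v w < 0 := by
    rw [inner_sub_right, real_inner_self_eq_norm_sq, hv.1]
    linarith
  have h2 : 0 < inner ℝ n w := by
    rw [inner_sub_right, real_inner_self_eq_norm_sq, hn1, real_inner_comm]
    linarith
  have hline : HasDerivAt (fun t : ℝ => y + t • w) w 0 := by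
    simpa using ((hasDerivAt_id (0 : ℝ)).smul_const w).const_add y
  have hder : HasDerivAt (fun t : ℝ => graphHeight j s γ (y + t • w)) (-(‖N‖ * inner ℝ n w)) 0 := by
    have h3 := hasFDerivAt_graphHeight j s hγ (y + (0 : ℝ) • w)
    refine (h3.comp_hasDerivAt 0 hline).congr_deriv ?_
    rw [zero_smul, add_zero, neg_apply, smul_apply, innerSL_apply_apply, smul_eq_mul,
      ← real_inner_smul_left, ← real_inner_smul_left, hNn]
  have hslope := (hasDerivAt_iff_tendsto_slope.1 hder).eventually
    (gt_mem_nhds (neg_neg_of_pos (mul_pos hN h2)))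
  have hslope' := hslope.filter_mono (nhdsGT_le_nhdsNE (0 : ℝ))
  have hUev : ∀ᶠ t : ℝ in 𝓝[>] 0, y + t • w ∈ U := by
    have hc : Tendsto (fun t : ℝ => y + t • w) (𝓝[>] 0) (𝓝 y) := by
      simpa using hline.continuousAt.tendsto.mono_left nhdsWithin_le_nhds
    exact hc.eventually (hUo.mem_nhds hy)
  obtain ⟨t, ⟨⟨ht1, ht2⟩, ht3⟩, ht4⟩ :=
    (((hslope'.and (hv.2.1 w h1)).and hUev).and self_mem_nhdsWithin).exists
  have hpos := (hU _ ht3).1 ht2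
  have ht0 : (0 : ℝ) < t := ht4
  rw [slope_def_field, zero_smul, add_zero, hy0, sub_zero, sub_zero, div_neg_iff] at ht1
  rcases ht1 with h | h
  · exact lt_asymm ht0 h.2
  · exact lt_asymm hpos h.1

end Boundary

variable {E : Type*} [NormedAddCommGroup E] [NormedSpace ℝ E] [CompleteSpace E]
  {G : Fin (p + 1) → EuclideanSpace ℝ (Fin (p + 1)) → E} {g : EuclideanSpace ℝ (Fin (p + 1)) → E}
  {ν : EuclideanSpace ℝ (Fin (p + 1)) → EuclideanSpace ℝ (Fin (p + 1))}

/-- Gauss's formula holds for vector fields cut off near a given point of the closed domain. -/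
theorem exists_isOpen_gauss_formula (hD : IsOpen D) (hb : HasSmoothBoundary D)
    (hν : ∀ y ∈ frontier D, IsOutwardUnitNormal D y (ν y)) (hG : ∀ i, Continuous (G i))
    (hg : Continuous g) (hGd : ∀ i, DifferentiableOn ℝ (G i) D)
    (hdiv : ∀ y ∈ D, ∑ i, fderiv ℝ (G i) y (EuclideanSpace.single i 1) = g y)
    {y₀ : EuclideanSpace ℝ (Fin (p + 1))} (hy₀ : y₀ ∈ closure D) :
    ∃ O : Set (EuclideanSpace ℝ (Fin (p + 1))), IsOpen O ∧ y₀ ∈ O ∧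
      ∀ χ : EuclideanSpace ℝ (Fin (p + 1)) → ℝ, ContDiff ℝ 1 χ → HasCompactSupport χ →
        tsupport χ ⊆ O →
        IntegrableOn (fun y => χ y • ∑ i, ν y i • G i y) (frontier D)
          (Measure.euclideanHausdorffMeasure p) ∧
        ∫ y in frontier D, χ y • ∑ i, ν y i • G i y ∂(Measure.euclideanHausdorffMeasure p) =
          ∫ y in D, ((∑ i, fderiv ℝ χ y (EuclideanSpace.single i 1) • G i y) + χ y • g y) := by
  by_cases hyD : y₀ ∈ D
  · refine ⟨D, hD, hyD, fun χ hχ hχc hχD => ?_⟩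
    have h0 : ∀ y ∈ frontier D, χ y • ∑ i, ν y i • G i y = 0 := fun y hy => by
      have : y ∉ tsupport χ := fun h => by
        rw [hD.frontier_eq] at hy
        exact hy.2 (hχD h)
      rw [image_eq_zero_of_notMem_tsupport this, zero_smul]
    refine ⟨integrableOn_zero.congr_fun (fun y hy => (h0 y hy).symm)
      isClosed_frontier.measurableSet, ?_⟩
    rw [setIntegral_eq_zero_of_forall_eq_zero h0, setIntegral_eq_integral_of_forall_compl_eq_zero,
      integral_fderiv_smul_add_smul_eq_zero hD hG hg hGd hdiv hχ hχc hχD]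
    intro y hy
    have hy' : y ∉ tsupport χ := fun h => hy (hχD h)
    have h2 : fderiv ℝ χ y = 0 := by
      by_contra h
      exact hy' (support_fderiv_subset ℝ h)
    simp [h2, image_eq_zero_of_notMem_tsupport hy']
  · have hyf : y₀ ∈ frontier D := by
      rw [hD.frontier_eq]
      exact ⟨hy₀, hyD⟩
    obtain ⟨j, s, γ, U, hs, hγ, hUo, hyU, hU⟩ := hb y₀ hyf
    have hs' : s * s = 1 := mul_self_eq_one_iff.2 hs
    have hγ1 : ContDiff ℝ 1 γ := hγ.of_le (by simp)
    have hU' : ∀ z ∈ U, z ∈ D ↔ 0 < graphHeight j s γ z := fun z hz => by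
      rw [hU z hz, graphHeight, mul_sub, sub_pos, removeCoord_eq]
    refine ⟨U, hUo, hyU, fun χ hχ hχc hχU => ?_⟩
    have hfr : ∀ z ∈ U, z ∈ frontier D ↔ z ∈ Set.range (graphMap j γ) := fun z hz => by
      rw [mem_frontier_iff_graphHeight_eq_zero hD hs' hγ.continuous hUo hU' hz,
        graphHeight_eq_zero_iff hs']
      refine ⟨fun h => ⟨_, h⟩, ?_⟩
      rintro ⟨w, rfl⟩
      simp [graphMap]
    set F : EuclideanSpace ℝ (Fin (p + 1)) → E := fun y => χ y • ∑ i, ν y i • G i y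
    -- The frontier and the whole graph may differ outside `U`, but `F` vanishes there.
    have hind : (frontier D).indicator F = (Set.range (graphMap j γ)).indicator F := by
      ext z
      by_cases hz : z ∈ tsupport χ
      · have := hfr z (hχU hz)
        by_cases h : z ∈ frontier D
        · rw [Set.indicator_of_mem h, Set.indicator_of_mem (this.1 h)]
        · rw [Set.indicator_of_notMem h, Set.indicator_of_notMem (fun h' => h (this.2 h'))]
      · have : F z = 0 := by
          simp only [F, image_eq_zero_of_notMem_tsupport hz, zero_smul]
        simp [Set.indicator, this]
    have hmf : MeasurableSet (frontier D) := isClosed_frontier.measurableSet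
    have hmr : MeasurableSet (Set.range (graphMap j γ)) :=
      (isClosedEmbedding_graphMap j hγ.continuous).isClosed_range.measurableSet
    -- The Jacobian `‖graphNormal j γ w‖` cancels the normalization of `ν`.
    have hpull : ∀ w, ‖graphNormal j γ w‖ • F (graphMap j γ w) =
        χ (graphMap j γ w) • ∑ i, (s * graphNormal j γ w i) • G i (graphMap j γ w) := fun w => by
      by_cases hz : graphMap j γ w ∈ tsupport χ
      · have hzf := (hfr _ (hχU hz)).2 ⟨w, rfl⟩
        have hz0 := (mem_frontier_iff_graphHeight_eq_zero hD hs' hγ.continuous hUo hU'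
          (hχU hz)).1 hzf
        have hn := norm_smul_eq_of_isOutwardUnitNormal hs' hγ1 hUo hU' (hχU hz) hz0 (hν _ hzf)
        have hw : removeCoord j (graphMap j γ w) = w := by simp [graphMap]
        rw [hw] at hn
        have hi : ∀ i, ‖graphNormal j γ w‖ * ν (graphMap j γ w) i = s * graphNormal j γ w i :=
          fun i => by simpa using congrArg (fun z => z i) hn
        simp only [F]
        rw [smul_comm, Finset.smul_sum]
        simp only [smul_smul, hi]
      · simp only [F, image_eq_zero_of_notMem_tsupport hz, zero_smul, smul_zero]
    constructor
    · rw [← integrable_indicator_iff hmf, hind, integrable_indicator_iff hmr,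
        integrableOn_range_graphMap_iff j hγ1]
      simp only [hpull]
      have hΓ := isClosedEmbedding_graphMap j hγ.continuous
      have hΓc := hΓ.continuous
      have hNc := continuous_graphNormal j hγ1
      have hχ0 := hχ.continuous
      have hcont : Continuous fun w => χ (graphMap j γ w) •
          ∑ i, (s * graphNormal j γ w i) • G i (graphMap j γ w) :=
        (hχ0.comp hΓc).smul (continuous_finsetSum _ fun i _ =>
          (continuous_const.mul ((EuclideanSpace.proj (𝕜 := ℝ) i).continuous.comp hNc)).smul
            ((hG i).comp hΓc))
      have hsupp : HasCompactSupport (χ ∘ graphMap j γ) := hχc.comp_isClosedEmbedding hΓ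
      exact hcont.integrable_of_hasCompactSupport
        (hsupp.smul_right (f' := fun w => ∑ i, (s * graphNormal j γ w i) • G i (graphMap j γ w)))
    · rw [← integral_indicator hmf, hind, integral_indicator hmr,
        setIntegral_range_graphMap j hγ1,
        setIntegral_fderiv_smul_add_smul_eq_of_graph hD hG hg hGd hdiv hs' hγ1 hU' hχ hχc hχU]
      simp only [hpull]

/-- **Gauss's theorem** on a bounded domain with smooth boundary, for a continuous vector field
which is differentiable inside the domain, with continuous divergence. -/
theorem integral_frontier_inner_normal_eq (hD : IsOpen D) (hDb : Bornology.IsBounded D)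
    (hb : HasSmoothBoundary D)
    (hν : ∀ y ∈ frontier D, IsOutwardUnitNormal D y (ν y)) (hG : ∀ i, Continuous (G i))
    (hg : Continuous g) (hGd : ∀ i, DifferentiableOn ℝ (G i) D)
    (hdiv : ∀ y ∈ D, ∑ i, fderiv ℝ (G i) y (EuclideanSpace.single i 1) = g y) :
    IntegrableOn (fun y => ∑ i, ν y i • G i y) (frontier D)
      (Measure.euclideanHausdorffMeasure p) ∧
    ∫ y in frontier D, ∑ i, ν y i • G i y ∂(Measure.euclideanHausdorffMeasure p) =
      ∫ y in D, g y := by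
  have hK : IsCompact (closure D) := hDb.isCompact_closure
  choose! O hO hyO hgauss using fun y (hy : y ∈ closure D) =>
    exists_isOpen_gauss_formula hD hb hν hG hg hGd hdiv hy
  -- Intersecting with unit balls makes the supports of the partition functions compact.
  obtain ⟨t, ht, hcov⟩ := hK.elim_nhds_subcover (fun y => O y ∩ Metric.ball y 1) fun y hy =>
    inter_mem ((hO y hy).mem_nhds (hyO y hy)) (Metric.ball_mem_nhds y one_pos)
  obtain ⟨f, hf⟩ := SmoothPartitionOfUnity.exists_isSubordinate
    (modelWithCornersSelf ℝ (EuclideanSpace ℝ (Fin (p + 1)))) hK.isClosed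
    (fun y : t => O y ∩ Metric.ball (y : EuclideanSpace ℝ (Fin (p + 1))) 1)
    (fun y => (hO y (ht y y.2)).inter Metric.isOpen_ball)
    (fun y hy => by simpa [Set.mem_iUnion] using hcov hy)
  have hfd : ∀ k, ContDiff ℝ 1 (f k) := fun k => (f k).contMDiff.contDiff.of_le (by simp)
  have hfc : ∀ k, HasCompactSupport (f k) := fun k =>
    Metric.isCompact_of_isClosed_isBounded (isClosed_tsupport _)
      (Metric.isBounded_ball.subset ((hf k).trans Set.inter_subset_right))
  have hsum : ∀ y ∈ closure D, ∑ k, f k y = 1 := fun y hy => by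
    rw [← finsum_eq_sum_of_fintype]
    exact f.sum_eq_one hy
  have hloc := fun k : t =>
    hgauss k (ht k k.2) (f k) (hfd k) (hfc k) ((hf k).trans Set.inter_subset_left)
  have hmf : MeasurableSet (frontier D) := isClosed_frontier.measurableSet
  have hfr : ∀ y ∈ frontier D,
      ∑ k, f k y • ∑ i, ν y i • G i y = ∑ i, ν y i • G i y := fun y hy => by
    rw [← Finset.sum_smul, hsum y (frontier_subset_closure hy), one_smul]
  -- The partition functions sum to 1 on the open set `D`, so their gradients cancel there.
  have hder : ∀ y ∈ D, ∑ k, fderiv ℝ (f k) y = 0 := fun y hy => by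
    rw [← fderiv_fun_sum fun k _ => (hfd k).differentiable one_ne_zero y]
    have : (fun z => ∑ k, f k z) =ᶠ[𝓝 y] fun _ => 1 := by
      filter_upwards [hD.mem_nhds hy] with z hz using hsum z (subset_closure hz)
    rw [this.fderiv_eq, fderiv_fun_const]
    rfl
  have hin : ∀ y ∈ D, ∑ k, ((∑ i, fderiv ℝ (f k) y (EuclideanSpace.single i 1) • G i y) +
      f k y • g y) = g y := fun y hy => by
    rw [Finset.sum_add_distrib, ← Finset.sum_smul, hsum y (subset_closure hy), one_smul,
      Finset.sum_comm, Finset.sum_eq_zero, zero_add]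
    intro i _
    rw [← Finset.sum_smul, ← _root_.sum_apply, hder y hy, _root_.zero_apply, zero_smul]
  have hint : ∀ k, IntegrableOn (fun y =>
      (∑ i, fderiv ℝ (f k) y (EuclideanSpace.single i 1) • G i y) + f k y • g y) D := fun k => by
    have h1 := (hfd k).continuous_fderiv one_ne_zero
    have h2 := (hfd k).continuous
    have h3 : Continuous fun y =>
      (∑ i, fderiv ℝ (f k) y (EuclideanSpace.single i 1) • G i y) + f k y • g y := by fun_prop
    exact (h3.continuousOn.integrableOn_compact hK).mono_set subset_closure
  constructor
  · refine IntegrableOn.congr_fun (integrable_finsetSum _ fun k _ => (hloc k).1) hfr hmf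
  · rw [← setIntegral_congr_fun hmf hfr, integral_finsetSum _ fun k _ => (hloc k).1,
      Finset.sum_congr rfl fun k _ => (hloc k).2, ← integral_finsetSum _ fun k _ => hint k]
    exact setIntegral_congr_fun hD.measurableSet hin

end Gauss

/-! ### The smoothed radial kernel. -/

section Radial

/-- A smooth function of `t = ‖z‖²`, equal to `‖z‖⁻ⁿ` for `‖z‖ ≥ 1` and vanishing near the
origin. -/
def radialCutoff (n : ℕ) (t : ℝ) : ℝ :=
  Real.smoothTransition (2 * t - 1) * t ^ (-(n : ℝ) / 2)

/-- The divergence of `z ↦ radialCutoff n (‖z‖²) z` in `ℝⁿ`, as a function of `t = ‖z‖²`. -/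
def radialDensity (n : ℕ) (t : ℝ) : ℝ :=
  n * radialCutoff n t + 2 * t * deriv (radialCutoff n) t

theorem contDiff_radialCutoff (n : ℕ) : ContDiff ℝ 1 (radialCutoff n) := by
  refine contDiff_iff_contDiffAt.2 fun t => ?_
  by_cases ht : t < 1 / 2
  · have : radialCutoff n =ᶠ[𝓝 t] fun _ => 0 := by
      filter_upwards [Iio_mem_nhds ht] with u hu
      rw [radialCutoff, Real.smoothTransition.zero_of_nonpos, zero_mul]
      have : u < 1 / 2 := hu
      linarith
    exact contDiffAt_const.congr_of_eventuallyEq this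
  · have h0 : t ≠ 0 := by rintro rfl; norm_num at ht
    refine ContDiffAt.mul (Real.smoothTransition.contDiff.contDiffAt.comp t (by fun_prop)) ?_
    exact contDiffAt_id.rpow_const_of_ne h0

theorem continuous_radialDensity (n : ℕ) : Continuous (radialDensity n) := by
  have h1 := (contDiff_radialCutoff n).continuous
  have h2 := (contDiff_radialCutoff n).continuous_deriv le_rfl
  unfold radialDensity
  fun_prop

theorem radialCutoff_sq_of_one_le (n : ℕ) {a : ℝ} (ha : 1 ≤ a) :
    radialCutoff n (a ^ 2) = (a ^ n)⁻¹ := by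
  have h0 : 0 ≤ a := zero_le_one.trans ha
  rw [radialCutoff, Real.smoothTransition.one_of_one_le (by nlinarith), one_mul,
    ← Real.rpow_natCast a 2, ← Real.rpow_mul h0, ← Real.rpow_natCast a n, ← Real.rpow_neg h0]
  congr 1
  push_cast
  ring

/-- The operator $n+2t\,\frac{d}{dt}$ annihilates $t^{-n/2}$, so only the derivative of the
transition survives. Nonnegativity and the vanishing for $t>1$ are read off from this. -/
theorem radialDensity_of_pos (n : ℕ) {t : ℝ} (ht : 0 < t) :
    radialDensity n t =
      2 * t * t ^ (-(n : ℝ) / 2) * deriv (fun u => Real.smoothTransition (2 * u - 1)) t := by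
  have hd : DifferentiableAt ℝ (fun u => Real.smoothTransition (2 * u - 1)) t :=
    ((Real.smoothTransition.contDiff (n := 1)).comp
      (by fun_prop : ContDiff ℝ 1 fun u : ℝ => 2 * u - 1)).differentiable one_ne_zero t
  have h1 : HasDerivAt (radialCutoff n) _ t :=
    hd.hasDerivAt.mul (Real.hasDerivAt_rpow_const (p := -(n : ℝ) / 2) (Or.inl ht.ne'))
  rw [radialDensity, h1.deriv, radialCutoff, Real.rpow_sub_one ht.ne']
  field_simp
  ring

theorem monotone_smoothTransition_two_mul_sub_one :
    Monotone fun u : ℝ => Real.smoothTransition (2 * u - 1) :=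
  fun _ _ h => Real.smoothTransition.monotone (by linarith)

theorem radialDensity_nonneg (n : ℕ) {t : ℝ} (ht : 0 ≤ t) : 0 ≤ radialDensity n t := by
  rcases ht.eq_or_lt with rfl | ht
  · simp [radialDensity, radialCutoff, Real.smoothTransition.zero_of_nonpos]
  · rw [radialDensity_of_pos n ht]
    have : 0 ≤ deriv (fun u => Real.smoothTransition (2 * u - 1)) t :=
      monotone_smoothTransition_two_mul_sub_one.deriv_nonneg
    positivity

theorem radialDensity_of_one_lt (n : ℕ) {t : ℝ} (ht : 1 < t) : radialDensity n t = 0 := by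
  rw [radialDensity_of_pos n (zero_lt_one.trans ht)]
  have : (fun u => Real.smoothTransition (2 * u - 1)) =ᶠ[𝓝 t] fun _ => 1 := by
    filter_upwards [Ioi_mem_nhds ht] with u hu
    have : 1 < u := hu
    exact Real.smoothTransition.one_of_one_le (by linarith)
  rw [this.deriv_eq, deriv_const, mul_zero]

theorem exists_radialDensity_ne_zero (n : ℕ) : ∃ t, 0 ≤ t ∧ radialDensity n t ≠ 0 := by
  have hd : Differentiable ℝ fun u => Real.smoothTransition (2 * u - 1) :=
    ((Real.smoothTransition.contDiff (n := 1)).comp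
      (by fun_prop : ContDiff ℝ 1 fun u : ℝ => 2 * u - 1)).differentiable one_ne_zero
  -- The transition rises from 0 at `u = 0` to 1 at `u = 1`, so its derivative equals 1 somewhere
  -- between.
  obtain ⟨t, ht, h⟩ := exists_deriv_eq_slope (fun u => Real.smoothTransition (2 * u - 1))
    (zero_lt_one' ℝ) hd.continuous.continuousOn hd.differentiableOn
  refine ⟨t, ht.1.le, ?_⟩
  rw [radialDensity_of_pos n ht.1, h, Real.smoothTransition.one_of_one_le (by norm_num),
    Real.smoothTransition.zero_of_nonpos (by norm_num)]
  have := Real.rpow_pos_of_pos ht.1 (-(n : ℝ) / 2)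
  have := ht.1
  positivity

variable {p : ℕ}

theorem continuous_radialDensity_norm_sq (n : ℕ) :
    Continuous fun z : EuclideanSpace ℝ (Fin (p + 1)) => radialDensity n (‖z‖ ^ 2) :=
  (continuous_radialDensity n).comp (by fun_prop)

theorem radialDensity_norm_sq_of_one_lt (n : ℕ) {z : EuclideanSpace ℝ (Fin (p + 1))}
    (hz : 1 < ‖z‖) : radialDensity n (‖z‖ ^ 2) = 0 :=
  radialDensity_of_one_lt n (by nlinarith)

theorem hasCompactSupport_radialDensity_norm_sq (n : ℕ) :
    HasCompactSupport fun z : EuclideanSpace ℝ (Fin (p + 1)) => radialDensity n (‖z‖ ^ 2) :=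
  HasCompactSupport.intro (isCompact_closedBall 0 1) fun z hz =>
    radialDensity_norm_sq_of_one_lt n (by simpa using hz)

theorem integral_radialDensity_pos (n : ℕ) :
    0 < ∫ z : EuclideanSpace ℝ (Fin (p + 1)), radialDensity n (‖z‖ ^ 2) := by
  obtain ⟨t, ht, h⟩ := exists_radialDensity_ne_zero n
  refine (continuous_radialDensity_norm_sq n).integral_pos_of_hasCompactSupport_nonneg_nonzero
    (x := EuclideanSpace.single 0 (Real.sqrt t)) (hasCompactSupport_radialDensity_norm_sq n)
    (fun z => radialDensity_nonneg n (by positivity)) ?_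
  simpa [Real.sq_sqrt ht] using h

end Radial

/-! ### From an adapted kernel to the Cauchy formula. -/

section CauchyFormula

variable {A : Type*} [NormedRing A] [NormedAlgebra ℝ A] {p : ℕ}
  {D : Set (EuclideanSpace ℝ (Fin (p + 1)))}
  {ν : EuclideanSpace ℝ (Fin (p + 1)) → EuclideanSpace ℝ (Fin (p + 1))}
  {Φ : Fin (p + 1) → EuclideanSpace ℝ (Fin (p + 1)) →L[ℝ] A}
  {f : EuclideanSpace ℝ (Fin (p + 1)) → A} {c : ℝ}

/-- The product rule gives three sums. The derivatives of `f` are annihilated by `Φ`, the trace of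
`Φ` gives the term with the cutoff, and the radial contraction gives the term with its derivative.
Together the last two are `c` times `radialDensity`. -/
theorem sum_fderiv_radialCutoff_smul_mul
    (hΦ : ∀ z, ∑ i, z i • Φ i z = (c * ‖z‖ ^ 2) • (1 : A))
    (hΦtr : ∑ i, Φ i (EuclideanSpace.single i 1) = ((p + 1 : ℕ) * c) • (1 : A))
    {x y : EuclideanSpace ℝ (Fin (p + 1))} (hf : DifferentiableAt ℝ f y)
    (hfΦ : ∀ z, ∑ i, Φ i z * fderiv ℝ f y (EuclideanSpace.single i 1) = 0) (r : ℝ) :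
    (∀ i, DifferentiableAt ℝ (fun y => radialCutoff (p + 1) (‖r⁻¹ • (y - x)‖ ^ 2) •
      (Φ i (y - x) * f y)) y) ∧
    ∑ i, fderiv ℝ (fun y => radialCutoff (p + 1) (‖r⁻¹ • (y - x)‖ ^ 2) • (Φ i (y - x) * f y)) y
      (EuclideanSpace.single i 1) =
      (c * radialDensity (p + 1) (‖r⁻¹ • (y - x)‖ ^ 2)) • f y := by
  set T := ‖r⁻¹ • (y - x)‖ ^ 2 with hT
  have hsub : HasFDerivAt (fun y => y - x) (ContinuousLinearMap.id ℝ _) y :=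
    (hasFDerivAt_id y).sub_const x
  have h1 : HasFDerivAt (fun y => ‖r⁻¹ • (y - x)‖ ^ 2) _ y := (hsub.const_smul r⁻¹).norm_sq
  have h2 : HasDerivAt (radialCutoff (p + 1)) (deriv (radialCutoff (p + 1)) T) T :=
    ((contDiff_radialCutoff _).differentiable one_ne_zero _).hasDerivAt
  have h3 := h2.comp_hasFDerivAt y h1
  simp only [Function.comp_def] at h3
  have h4 : ∀ i, HasFDerivAt (fun y => Φ i (y - x) * f y) _ y := fun i =>
    ((Φ i).hasFDerivAt.comp y hsub).mul' hf.hasFDerivAt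
  have h5 := fun i => h3.fun_smul (h4 i)
  refine ⟨fun i => (h5 i).differentiableAt, ?_⟩
  have h6 : ∀ i, fderiv ℝ (fun y => radialCutoff (p + 1) (‖r⁻¹ • (y - x)‖ ^ 2) •
      (Φ i (y - x) * f y)) y (EuclideanSpace.single i 1) =
      radialCutoff (p + 1) T • (Φ i (y - x) * fderiv ℝ f y (EuclideanSpace.single i 1)) +
      radialCutoff (p + 1) T • (Φ i (EuclideanSpace.single i 1) * f y) +
      (deriv (radialCutoff (p + 1)) T * (2 * r⁻¹ ^ 2)) •
        (((y - x) i • Φ i (y - x)) * f y) := by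
    intro i
    rw [(h5 i).fderiv]
    simp [EuclideanSpace.inner_single_right, smul_smul, T]
    ring_nf
  have h7 : T = r⁻¹ ^ 2 * ‖y - x‖ ^ 2 := by
    rw [hT, norm_smul, mul_pow, Real.norm_eq_abs, sq_abs]
  simp only [h6, Finset.sum_add_distrib, ← Finset.smul_sum, ← Finset.sum_mul, hfΦ, hΦ, hΦtr]
  simp only [smul_zero, zero_add, smul_mul_assoc, one_mul, smul_smul, ← add_smul]
  congr 1
  rw [radialDensity]
  generalize deriv (radialCutoff (p + 1)) T = a
  generalize radialCutoff (p + 1) T = b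
  rw [h7]
  ring

variable [CompleteSpace A]

/-- The right side is a weighted average of `f` at scale `r`, while the left side does not depend on
`r`; this is what permits the limit `r → 0`. -/
theorem integral_cauchy_kernel_eq (hD : IsOpen D) (hDb : Bornology.IsBounded D)
    (hb : HasSmoothBoundary D) (hν : ∀ y ∈ frontier D, IsOutwardUnitNormal D y (ν y))
    (hΦ : ∀ z, ∑ i, z i • Φ i z = (c * ‖z‖ ^ 2) • (1 : A))
    (hΦtr : ∑ i, Φ i (EuclideanSpace.single i 1) = ((p + 1 : ℕ) * c) • (1 : A))
    (hfc : Continuous f) (hf : ∀ y ∈ D, DifferentiableAt ℝ f y)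
    (hfΦ : ∀ y ∈ D, ∀ z, ∑ i, Φ i z * fderiv ℝ f y (EuclideanSpace.single i 1) = 0)
    {x : EuclideanSpace ℝ (Fin (p + 1))} {r : ℝ} (hr : 0 < r) (hrD : Metric.closedBall x r ⊆ D) :
    IntegrableOn (fun y => ((‖y - x‖ ^ (p + 1))⁻¹ • ∑ i, ν y i • Φ i (y - x)) * f y) (frontier D)
      (Measure.euclideanHausdorffMeasure p) ∧
    ∫ y in frontier D, ((‖y - x‖ ^ (p + 1))⁻¹ • ∑ i, ν y i • Φ i (y - x)) * f y
      ∂(Measure.euclideanHausdorffMeasure p) =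
      c • ∫ z, radialDensity (p + 1) (‖z‖ ^ 2) • f (x + r • z) := by
  set G : Fin (p + 1) → EuclideanSpace ℝ (Fin (p + 1)) → A := fun i y =>
    radialCutoff (p + 1) (‖r⁻¹ • (y - x)‖ ^ 2) • (Φ i (y - x) * f y)
  set g : EuclideanSpace ℝ (Fin (p + 1)) → A := fun y =>
    (c * radialDensity (p + 1) (‖r⁻¹ • (y - x)‖ ^ 2)) • f y
  have hη := (contDiff_radialCutoff (p + 1)).continuous
  have hω := continuous_radialDensity (p + 1)
  have hdiv := fun y hy =>
    sum_fderiv_radialCutoff_smul_mul hΦ hΦtr (x := x) (hf y hy) (hfΦ y hy) r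
  obtain ⟨hi, he⟩ := integral_frontier_inner_normal_eq (G := G) (g := g) hD hDb hb hν
    (fun i => by fun_prop) (by fun_prop)
    (fun i y hy => ((hdiv y hy).1 i).differentiableWithinAt) fun y hy => (hdiv y hy).2
  have hmf : MeasurableSet (frontier D) := isClosed_frontier.measurableSet
  -- The boundary lies at distance at least `r` from `x`, where the cutoff is the pure power; its
  -- rescaling costs the factor `r ^ (p + 1)`, undone here.
  have hfr : ∀ y ∈ frontier D, (r⁻¹ ^ (p + 1)) • ∑ i, ν y i • G i y =
      ((‖y - x‖ ^ (p + 1))⁻¹ • ∑ i, ν y i • Φ i (y - x)) * f y := by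
    intro y hy
    have hyr : r ≤ ‖y - x‖ := by
      by_contra! h
      rw [hD.frontier_eq] at hy
      exact hy.2 (hrD (by rw [Metric.mem_closedBall, dist_eq_norm]; exact h.le))
    have h1 : radialCutoff (p + 1) (‖r⁻¹ • (y - x)‖ ^ 2) =
        r ^ (p + 1) * (‖y - x‖ ^ (p + 1))⁻¹ := by
      have hn : ‖r⁻¹ • (y - x)‖ = r⁻¹ * ‖y - x‖ := by
        rw [norm_smul, Real.norm_of_nonneg (inv_pos.2 hr).le]
      rw [radialCutoff_sq_of_one_le, hn, mul_pow, mul_inv, inv_pow, inv_inv]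
      rw [hn, inv_mul_eq_div, one_le_div hr]
      exact hyr
    simp only [G, h1, smul_mul_assoc, Finset.smul_sum, Finset.sum_mul, smul_smul]
    refine Finset.sum_congr rfl fun i _ => ?_
    congr 1
    rw [inv_pow]
    field_simp
  constructor
  · exact IntegrableOn.congr_fun (Integrable.smul (r⁻¹ ^ (p + 1)) hi) hfr hmf
  · rw [← setIntegral_congr_fun hmf hfr, integral_smul, he,
      setIntegral_eq_integral_of_forall_compl_eq_zero]
    · have h1 := Measure.integral_comp_smul (volume : Measure (EuclideanSpace ℝ (Fin (p + 1))))
        (fun z => g (x + z)) r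
      rw [integral_add_left_eq_self g x, finrank_euclideanSpace_fin,
        abs_of_pos (inv_pos.2 (pow_pos hr _)), ← inv_pow] at h1
      rw [← h1, ← integral_smul]
      refine integral_congr_ae (ae_of_all _ fun z => ?_)
      simp only [g, add_sub_cancel_left, smul_smul, inv_mul_cancel₀ hr.ne', one_smul]
    · intro y hy
      have hyr : r < ‖y - x‖ := by
        by_contra! h
        exact hy (hrD (by rwa [Metric.mem_closedBall, dist_eq_norm]))
      have : 1 < ‖r⁻¹ • (y - x)‖ := by
        rw [norm_smul, Real.norm_of_nonneg (inv_pos.2 hr).le, inv_mul_eq_div, one_lt_div hr]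
        exact hyr
      simp only [g, radialDensity_norm_sq_of_one_lt _ this, mul_zero, zero_smul]

/-- The Cauchy formula for a homogeneous kernel `Φ(z) / ‖z‖ⁿ` adapted to the equation of `f`. -/
theorem cauchy_formula_of_kernel (hD : IsOpen D) (hDb : Bornology.IsBounded D)
    (hb : HasSmoothBoundary D) (hν : ∀ y ∈ frontier D, IsOutwardUnitNormal D y (ν y))
    (hc : c * ∫ z : EuclideanSpace ℝ (Fin (p + 1)), radialDensity (p + 1) (‖z‖ ^ 2) = 1)
    (hΦ : ∀ z, ∑ i, z i • Φ i z = (c * ‖z‖ ^ 2) • (1 : A))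
    (hΦtr : ∑ i, Φ i (EuclideanSpace.single i 1) = ((p + 1 : ℕ) * c) • (1 : A))
    (hfc : Continuous f) (hf : ∀ y ∈ D, DifferentiableAt ℝ f y)
    (hfΦ : ∀ y ∈ D, ∀ z, ∑ i, Φ i z * fderiv ℝ f y (EuclideanSpace.single i 1) = 0)
    {x : EuclideanSpace ℝ (Fin (p + 1))} (hx : x ∈ D) :
    IntegrableOn (fun y => ((‖y - x‖ ^ (p + 1))⁻¹ • ∑ i, ν y i • Φ i (y - x)) * f y) (frontier D)
      (Measure.euclideanHausdorffMeasure p) ∧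
    f x = ∫ y in frontier D, ((‖y - x‖ ^ (p + 1))⁻¹ • ∑ i, ν y i • Φ i (y - x)) * f y
      ∂(Measure.euclideanHausdorffMeasure p) := by
  obtain ⟨R, hR, hRD⟩ := Metric.nhds_basis_closedBall.mem_iff.1 (hD.mem_nhds hx)
  have key := fun r (hr : r ∈ Set.Ioc 0 R) =>
    integral_cauchy_kernel_eq hD hDb hb hν hΦ hΦtr hfc hf hfΦ hr.1
      ((Metric.closedBall_subset_closedBall hr.2).trans hRD)
  refine ⟨(key R ⟨hR, le_rfl⟩).1, ?_⟩
  have hω := continuous_radialDensity_norm_sq (p := p) (p + 1)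
  have hωc := hasCompactSupport_radialDensity_norm_sq (p := p) (p + 1)
  obtain ⟨C, hC⟩ := (isCompact_closedBall x 1).exists_bound_of_continuousOn hfc.continuousOn
  have hlim : Tendsto (fun r : ℝ => c • ∫ z : EuclideanSpace ℝ (Fin (p + 1)),
      radialDensity (p + 1) (‖z‖ ^ 2) • f (x + r • z)) (𝓝[>] 0)
      (𝓝 (c • ∫ z : EuclideanSpace ℝ (Fin (p + 1)), radialDensity (p + 1) (‖z‖ ^ 2) • f x)) := by
    refine Tendsto.const_smul (tendsto_integral_filter_of_dominated_convergence
      (fun z => ‖radialDensity (p + 1) (‖z‖ ^ 2)‖ * C)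
      (Eventually.of_forall fun r => ?_) ?_
      ((hω.integrable_of_hasCompactSupport hωc).norm.mul_const C) (ae_of_all _ fun z => ?_)) c
    · have : Continuous fun z => radialDensity (p + 1) (‖z‖ ^ 2) • f (x + r • z) := by fun_prop
      exact this.aestronglyMeasurable
    · filter_upwards [Ioc_mem_nhdsGT zero_lt_one] with r hr
      refine ae_of_all _ fun z => ?_
      rw [norm_smul]
      by_cases hz : 1 < ‖z‖
      · simp [radialDensity_norm_sq_of_one_lt _ hz]
      · refine mul_le_mul_of_nonneg_left (hC _ ?_) (norm_nonneg _)
        rw [Metric.mem_closedBall, dist_eq_norm, add_sub_cancel_left, norm_smul,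
          Real.norm_of_nonneg hr.1.le]
        exact mul_le_one₀ hr.2 (norm_nonneg _) (not_lt.1 hz)
    · have : Continuous fun r : ℝ => radialDensity (p + 1) (‖z‖ ^ 2) • f (x + r • z) := by
        fun_prop
      simpa using (this.tendsto 0).mono_left nhdsWithin_le_nhds
  rw [integral_smul_const, smul_smul, hc, one_smul] at hlim
  refine tendsto_nhds_unique hlim (tendsto_const_nhds.congr' ?_)
  filter_upwards [Ioc_mem_nhdsGT hR] with r hr using (key r hr).2

end CauchyFormula

/-! ### Constructing the kernel from the ideal condition. -/

section Algebra

variable {A : Type*} [NormedRing A] {p : ℕ}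

/-- An element of the left ideal generated by commutators of basis elements is a contraction of the
products with an antisymmetric matrix. -/
theorem exists_antisymm_of_mem_span_commutator (e : Fin (p + 1) → A) {a : A}
    (ha : a ∈ Ideal.span
      {c : A | ∃ k m : Fin (p + 1), 0 < k ∧ k < m ∧ c = e m * e k - e k * e m}) :
    ∃ B : Fin p → Fin p → A, (∀ k m, B k m = -B m k) ∧
      a = ∑ k, ∑ m, B k m * (e m.succ * e k.succ) := by
  induction ha using Submodule.span_induction with
  | mem c hc =>
    obtain ⟨k, m, hk, hkm, rfl⟩ := hc
    obtain ⟨k, rfl⟩ := Fin.exists_succ_eq.2 hk.ne'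
    obtain ⟨m, rfl⟩ := Fin.exists_succ_eq.2 (hk.trans hkm).ne'
    -- A single commutator corresponds to an elementary antisymmetric matrix.
    refine ⟨fun k' m' => (if k' = k ∧ m' = m then 1 else 0) - if k' = m ∧ m' = k then 1 else 0,
      fun k' m' => by simp [and_comm], ?_⟩
    simp [sub_mul, Finset.sum_sub_distrib, ite_and, Finset.sum_ite_eq']
  | zero => exact ⟨0, by simp, by simp⟩
  | add a b _ _ ha hb =>
    obtain ⟨B, hB, rfl⟩ := ha
    obtain ⟨C, hC, rfl⟩ := hb
    refine ⟨fun k m => B k m + C k m, fun k m => ?_, ?_⟩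
    · simp only [hB k m, hC k m, neg_add]
    · simp only [add_mul, Finset.sum_add_distrib]
  | smul x a _ ha =>
    obtain ⟨B, hB, rfl⟩ := ha
    refine ⟨fun k m => x * B k m, fun k m => ?_, ?_⟩
    · simp only [hB k m, mul_neg]
    · simp only [smul_eq_mul, Finset.mul_sum, mul_assoc]

variable [NormedAlgebra ℝ A]

theorem sum_cauchyCoeff (e : Module.Basis (Fin (p + 1)) ℝ A) (m : Fin p) (u : Fin (p + 1) → A) :
    ∑ j, cauchyCoeff e j m * u j = u m.succ - e m.succ * u 0 := by
  rw [Fin.sum_univ_succ]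
  simp [cauchyCoeff, Fin.succ_ne_zero, sub_eq_neg_add]

theorem sum_smul_cauchyCoeff (e : Module.Basis (Fin (p + 1)) ℝ A) (m : Fin p)
    (v : Fin (p + 1) → ℝ) :
    ∑ j, v j • cauchyCoeff e j m = v m.succ • 1 - v 0 • e m.succ := by
  rw [Fin.sum_univ_succ]
  simp [cauchyCoeff, Fin.succ_ne_zero, sub_eq_neg_add]

/-- The numerator `∑_m φ_m(z) a^i_m` of the `i`-th component of the Cauchy kernel. -/
def cauchyField (e : Module.Basis (Fin (p + 1)) ℝ A) (b : Fin (p + 1) → Fin p → A)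
    (i : Fin (p + 1)) : EuclideanSpace ℝ (Fin (p + 1)) →L[ℝ] A :=
  LinearMap.toContinuousLinearMap
    { toFun := fun z => ∑ m, cauchyNumerator b m z * cauchyCoeff e i m
      map_add' := fun z w => by
        simp [cauchyNumerator, add_smul, Finset.sum_add_distrib, add_mul]
      map_smul' := fun c z => by
        simp [cauchyNumerator, mul_smul, Finset.smul_sum, Finset.sum_mul] }

theorem cauchyField_apply (e : Module.Basis (Fin (p + 1)) ℝ A) (b : Fin (p + 1) → Fin p → A)
    (i : Fin (p + 1)) (z : EuclideanSpace ℝ (Fin (p + 1))) :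
    cauchyField e b i z = ∑ m, cauchyNumerator b m z * cauchyCoeff e i m := rfl

theorem cauchyKernel_eq (e : Module.Basis (Fin (p + 1)) ℝ A) (b : Fin (p + 1) → Fin p → A)
    (x y v : EuclideanSpace ℝ (Fin (p + 1))) :
    cauchyKernel e b x y v =
      (‖y - x‖ ^ (p + 1))⁻¹ • ∑ i, v i • cauchyField e b i (y - x) := by
  simp only [cauchyKernel, cauchyField_apply, Finset.smul_sum, Finset.mul_sum, mul_smul_comm]
  rw [Finset.sum_comm]

/-- The coefficients of a Cauchy kernel, built from an antisymmetric matrix `B`. -/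
def cauchyMatrix (e : Module.Basis (Fin (p + 1)) ℝ A) (c : ℝ) (B : Fin p → Fin p → A)
    (i : Fin (p + 1)) (m : Fin p) : A :=
  Fin.cases (∑ l, (c • ((if m = l then 1 else 0) - B m l)) * e l.succ)
    (fun k => c • ((if k = m then 1 else 0) - B k m)) i

/-- This is where the relation for `B` enters: it turns the sum into `c` times the difference of
$\sum_{m\ge1}e_m^2$ and $\sum_{m\ge0}e_m^2$, which leaves only $-e_0^2=-1$. -/
theorem sum_cauchyMatrix_zero_mul (e : Module.Basis (Fin (p + 1)) ℝ A) (he : e 0 = 1) (c : ℝ)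
    {B : Fin p → Fin p → A} (hB : ∑ m, e m ^ 2 = ∑ k, ∑ m, B k m * (e m.succ * e k.succ)) :
    ∑ m, cauchyMatrix e c B 0 m * e m.succ = -(c • (1 : A)) := by
  rw [Fin.sum_univ_succ, he, one_pow] at hB
  have h : ∑ m, cauchyMatrix e c B 0 m * e m.succ =
      c • (∑ m : Fin p, e m.succ ^ 2 - ∑ k, ∑ m, B k m * (e m.succ * e k.succ)) := by
    simp [cauchyMatrix, Finset.sum_mul, sub_mul, Finset.sum_sub_distrib, Finset.smul_sum, mul_assoc,
      smul_sub, sq]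
  rw [h, ← hB, sub_add_cancel_right, smul_neg]

theorem antisymm_diag_eq_zero {B : Fin p → Fin p → A} (hB : ∀ k m, B k m = -B m k) (k : Fin p) :
    B k k = 0 := by
  have h : (2 : ℝ) • B k k = 0 := by
    rw [two_smul]
    nth_rewrite 1 [hB k k]
    exact neg_add_cancel _
  exact (smul_eq_zero.1 h).resolve_left two_ne_zero

theorem sum_smul_cauchyField (e : Module.Basis (Fin (p + 1)) ℝ A) (he : e 0 = 1) (c : ℝ)
    {B : Fin p → Fin p → A} (hBa : ∀ k m, B k m = -B m k)
    (hB : ∑ m, e m ^ 2 = ∑ k, ∑ m, B k m * (e m.succ * e k.succ))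
    (z : EuclideanSpace ℝ (Fin (p + 1))) :
    ∑ i, z i • cauchyField e (cauchyMatrix e c B) i z = (c * ‖z‖ ^ 2) • (1 : A) := by
  have h1 : ∑ i, z i • cauchyField e (cauchyMatrix e c B) i z =
      ∑ m, cauchyNumerator (cauchyMatrix e c B) m z * ∑ i, z i • cauchyCoeff e i m := by
    simp only [cauchyField_apply, Finset.smul_sum, Finset.mul_sum, mul_smul_comm]
    rw [Finset.sum_comm]
  have hnum : ∀ m, cauchyNumerator (cauchyMatrix e c B) m z =
      z 0 • cauchyMatrix e c B 0 m + ∑ k : Fin p, z k.succ • cauchyMatrix e c B k.succ m :=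
    fun m => by rw [cauchyNumerator, Fin.sum_univ_succ]
  have h2 : ∑ m, ∑ k : Fin p, (z k.succ * z m.succ) • cauchyMatrix e c B k.succ m =
      (c * ∑ k : Fin p, z k.succ ^ 2) • (1 : A) := by
    -- An antisymmetric matrix contracted with the symmetric $z_kz_m$ equals its own negative.
    have h3 : ∑ m, ∑ k : Fin p, (z k.succ * z m.succ) • B k m = 0 := by
      have h4 : ∑ m, ∑ k : Fin p, (z k.succ * z m.succ) • B k m =
          -∑ m, ∑ k : Fin p, (z k.succ * z m.succ) • B k m := by
        conv_lhs => rw [Finset.sum_comm]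
        simp only [← Finset.sum_neg_distrib, ← smul_neg]
        refine Finset.sum_congr rfl fun m _ => Finset.sum_congr rfl fun k _ => ?_
        rw [← hBa, mul_comm]
      have h5 : (2 : ℝ) • ∑ m, ∑ k : Fin p, (z k.succ * z m.succ) • B k m = 0 := by
        rw [two_smul]
        nth_rewrite 1 [h4]
        exact neg_add_cancel _
      exact (smul_eq_zero.1 h5).resolve_left two_ne_zero
    have h6 : ∀ m k : Fin p, (z k.succ * z m.succ) • cauchyMatrix e c B k.succ m =
        (if k = m then (c * z k.succ ^ 2) • (1 : A) else 0) -
          c • (z k.succ * z m.succ) • B k m := fun m k => by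
      simp only [cauchyMatrix, Fin.cases_succ]
      split_ifs with hkm
      · subst hkm
        module
      · module
    simp only [h6, Finset.sum_sub_distrib, ← Finset.smul_sum, h3]
    simp [Finset.mul_sum, Finset.sum_smul]
  -- The zeroth row of `cauchyMatrix` was chosen for this cancellation of the mixed terms $z_0z_m$.
  have h7 : ∑ m, (∑ k : Fin p, z k.succ • cauchyMatrix e c B k.succ m) * e m.succ =
      ∑ m : Fin p, z m.succ • cauchyMatrix e c B 0 m := by
    simp only [Finset.sum_mul, smul_mul_assoc]
    rw [Finset.sum_comm]
    refine Finset.sum_congr rfl fun k _ => ?_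
    rw [← Finset.smul_sum]
    simp only [cauchyMatrix, Fin.cases_succ, Fin.cases_zero]
  rw [h1]
  simp only [sum_smul_cauchyCoeff, hnum, mul_sub, mul_smul_comm, mul_one, add_mul, smul_add,
    smul_mul_assoc, Finset.sum_sub_distrib, Finset.sum_add_distrib, ← Finset.smul_sum,
    sum_cauchyMatrix_zero_mul e he c hB, h7]
  have h8 : ∑ m : Fin p, z m.succ • ∑ k : Fin p, z k.succ • cauchyMatrix e c B k.succ m =
      (c * ∑ k : Fin p, z k.succ ^ 2) • (1 : A) := by
    rw [← h2]
    simp only [Finset.smul_sum, smul_smul, mul_comm]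
  have h9 : ∑ m : Fin p, z m.succ • z 0 • cauchyMatrix e c B 0 m =
      z 0 • ∑ m : Fin p, z m.succ • cauchyMatrix e c B 0 m := by
    rw [Finset.smul_sum]
    exact Finset.sum_congr rfl fun m _ => smul_comm _ _ _
  rw [h8, h9, EuclideanSpace.real_norm_sq_eq, Fin.sum_univ_succ]
  module

/-- Each of the $p+1$ diagonal terms is $c$: the zeroth by the relation for `B`, the others because
`B` has zero diagonal. -/
theorem sum_cauchyField_single (e : Module.Basis (Fin (p + 1)) ℝ A) (he : e 0 = 1) (c : ℝ)
    {B : Fin p → Fin p → A} (hBa : ∀ k m, B k m = -B m k)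
    (hB : ∑ m, e m ^ 2 = ∑ k, ∑ m, B k m * (e m.succ * e k.succ)) :
    ∑ i, cauchyField e (cauchyMatrix e c B) i (EuclideanSpace.single i 1) =
      ((p + 1 : ℕ) * c) • (1 : A) := by
  have hnum : ∀ i m, cauchyNumerator (cauchyMatrix e c B) m (EuclideanSpace.single i 1) =
      cauchyMatrix e c B i m := fun i m => by
    simp [cauchyNumerator]
  have h0 : ∑ m, cauchyMatrix e c B 0 m * cauchyCoeff e 0 m = c • (1 : A) := by
    simp [cauchyCoeff, sum_cauchyMatrix_zero_mul e he c hB]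
  have hs : ∀ k : Fin p, ∑ m, cauchyMatrix e c B k.succ m * cauchyCoeff e k.succ m =
      c • (1 : A) := fun k => by
    simp [cauchyCoeff, Fin.succ_ne_zero, cauchyMatrix, antisymm_diag_eq_zero hBa]
  simp only [cauchyField_apply, hnum]
  rw [Fin.sum_univ_succ, h0, Finset.sum_congr rfl fun k _ => hs k]
  simp only [Finset.sum_const, Finset.card_univ, Fintype.card_fin, ← Nat.cast_smul_eq_nsmul ℝ]
  push_cast
  module

end Algebra

end

theorem mainTheorem5 {A : Type*} [NormedRing A] [NormedAlgebra ℝ A] {p : ℕ}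
    (e : Module.Basis (Fin (p + 1)) ℝ A) (he : e 0 = 1)
    (hA : ∑ m, e m ^ 2 ∈
      Ideal.span {c : A | ∃ k m : Fin (p + 1), 0 < k ∧ k < m ∧ c = e m * e k - e k * e m}) :
    ∃ b : Fin (p + 1) → Fin p → A,
      ∀ D : Set (EuclideanSpace ℝ (Fin (p + 1))),
        IsOpen D → Bornology.IsBounded D → HasSmoothBoundary D →
      ∀ ν : EuclideanSpace ℝ (Fin (p + 1)) → EuclideanSpace ℝ (Fin (p + 1)),
        (∀ y ∈ frontier D, IsOutwardUnitNormal D y (ν y)) →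
      ∀ f : EuclideanSpace ℝ (Fin (p + 1)) → A,
        ContinuousOn f (closure D) → IsLeftADifferentiableOn e f D →
      ∀ x ∈ D,
        IntegrableOn (fun y => cauchyKernel e b x y (ν y) * f y) (frontier D)
          (Measure.euclideanHausdorffMeasure p) ∧
        f x = ∫ y in frontier D, cauchyKernel e b x y (ν y) * f y
          ∂(Measure.euclideanHausdorffMeasure p) := by
  obtain ⟨B, hBa, hB⟩ := exists_antisymm_of_mem_span_commutator (⇑e) hA
  have : FiniteDimensional ℝ A := e.finiteDimensional_of_finite
  have : CompleteSpace A := FiniteDimensional.complete ℝ A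
  set κ := ∫ z : EuclideanSpace ℝ (Fin (p + 1)), radialDensity (p + 1) (‖z‖ ^ 2)
  have hκ : 0 < κ := integral_radialDensity_pos (p + 1)
  refine ⟨cauchyMatrix e κ⁻¹ B, fun D hD hDb hb ν hν f hfc hf x hx => ?_⟩
  have : TietzeExtension A := TietzeExtension.of_tvs ℝ
  -- Gauss's theorem is stated for globally continuous fields, so `f` is replaced by a Tietze
  -- extension from the closed domain; near each point of `D` nothing changes.
  obtain ⟨F, hF⟩ := ContinuousMap.exists_restrict_eq isClosed_closure
    (⟨(closure D).domRestrict f, hfc.domRestrict⟩ : C(closure D, A))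
  have hFf : Set.EqOn F f (closure D) := fun y hy =>
    congrArg (fun h : C(closure D, A) => h ⟨y, hy⟩) hF
  have hloc : ∀ y ∈ D, F =ᶠ[𝓝 y] f := fun y hy => by
    filter_upwards [hD.mem_nhds hy] with z hz using hFf (subset_closure hz)
  have hFeq : ∀ y ∈ D, ∀ z, ∑ i, cauchyField e (cauchyMatrix e κ⁻¹ B) i z *
      fderiv ℝ F y (EuclideanSpace.single i 1) = 0 := fun y hy z => by
    simp only [cauchyField_apply, Finset.sum_mul, mul_assoc]
    rw [Finset.sum_comm]
    refine Finset.sum_eq_zero fun m _ => ?_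
    rw [← Finset.mul_sum, sum_cauchyCoeff, (hloc y hy).fderiv_eq, (hf y hy).2 m, sub_self, mul_zero]
  obtain ⟨hi, hx'⟩ := cauchy_formula_of_kernel hD hDb hb hν (inv_mul_cancel₀ hκ.ne')
    (sum_smul_cauchyField e he κ⁻¹ hBa hB) (sum_cauchyField_single e he κ⁻¹ hBa hB) F.continuous
    (fun y hy => (hf y hy).1.congr_of_eventuallyEq (hloc y hy)) hFeq hx
  have hmf : MeasurableSet (frontier D) := isClosed_frontier.measurableSet
  have hcongr : Set.EqOn (fun y => ((‖y - x‖ ^ (p + 1))⁻¹ •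
      ∑ i, ν y i • cauchyField e (cauchyMatrix e κ⁻¹ B) i (y - x)) * F y)
      (fun y => cauchyKernel e (cauchyMatrix e κ⁻¹ B) x y (ν y) * f y) (frontier D) := fun y hy => by
    simp only [cauchyKernel_eq, hFf (frontier_subset_closure hy)]
  refine ⟨hi.congr_fun hcongr hmf, ?_⟩
  rw [← hFf (subset_closure hx), hx']
  exact setIntegral_congr_fun hmf hcongr
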